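/- Let $\mathcal{L}$ be the language of propositional logic (over an arbitrary set of atoms) or the set of sentences of predicate logic without equality (over an arbitrary signature $L$), with connectives $\bot,\neg,\wedge,\vee,\to,\leftrightarrow$ (and quantifiers $\forall,\exists$), where $\top$ abbreviates $\neg\bot$. A set $S\subseteq\mathcal L$ is *inconsistent* if no interpretation (valuation, respectively structure with non-empty domain) makes all its elements true, and *minimal inconsistent* if moreover no proper subset of it is inconsistent. An *argument* is a pair $(S,\varphi)$ of a set $S$ of propositions and a proposition $\varphi$. An *argumentation tableau* is a finite tree whose nodes are labelled by sets of arguments and in which the children of every non-leaf node $\Gamma$ are obtained by applying one of the following rules to arguments in $\Gamma$: the arguments in the $i$-th alternative (alternatives are separated by $\mid$) of the conclusion of the rule are added to $\Gamma$ to give the $i$-th child. * $(S,\varphi\wedge\psi)$ gives $(S,\varphi),(S,\psi)$; $(S,\varphi\vee\psi)$ gives $(S,\varphi)\mid(S,\psi)$; $(S,\varphi\to\psi)$ gives $(S,\neg\varphi)\mid(S,\psi)$; $(S,\varphi\leftrightarrow\psi)$ gives $(S,\varphi\to\psi),(S,\psi\to\varphi)$; * $(S,\neg(\varphi\vee\psi))$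 gives $(S,\neg\varphi),(S,\neg\psi)$; $(S,\neg(\varphi\wedge\psi))$ gives $(S,\neg\varphi)\mid(S,\neg\psi)$; $(S,\neg(\varphi\to\psi))$ gives $(S,\varphi),(S,\neg\psi)$; $(S,\neg(\varphi\leftrightarrow\psi))$ gives $(S,\neg(\varphi\to\psi))\mid(S,\neg(\psi\to\varphi))$; $(S,\neg\neg\varphi)$ gives $(S,\varphi)$; * $(S,\varphi)$ and $(S',\neg\varphi)$ give $(S\cup S',\bot)$; * in predicate logic moreover: $(S,\forall x\,\varphi)$ gives $(S,\varphi[x/t])$; $(S,\neg\exists x\,\varphi)$ gives $(S,\neg\varphi[x/t])$; $(S,\exists x\,\varphi)$ gives $(S,\varphi[x/c])$; $(S,\neg\forall x\,\varphi)$ gives $(S,\neg\varphi[x/c])$. Here $c$ is a constant that does not occur in the node $\Gamma$, and $t$ is a ground term that occurs in $\Gamma$ or, if no ground term occurs in $\Gamma$, any constant. Constants and ground terms of the tableau are those of the signature $L$ extended by countably infinitely many additional constants, so that new constants are always available. A *support for the closure* of a tableau with leaves $\Lambda_1,\dots,\Lambda_n$ is a set $S=\bigcup_{i=1}^n S_i$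 with $(S_i,\bot)\in\Lambda_i$ for every $i$. A tableau $\mathcal T'$ *extends* $\mathcal T$ if it arises from $\mathcal T$ by applying further (possibly zero) rules at the leaves. **Proposition.** Let $\Sigma\subseteq\mathcal L$ and let $\mathcal T$ be an argumentation tableau with root node $\{(\{\sigma\},\sigma)\mid\sigma\in\Sigma\}$. This holds for both propositional and predicate logic: 1. If $S$ is a support for the closure of $\mathcal T$, then $S\subseteq\Sigma$ and $S$ is inconsistent. 2. If $S\subseteq\Sigma$ is a minimal inconsistent set, then there is a tableau $\mathcal T'$ which extends $\mathcal T$ such that $S$ is a support for the closure of $\mathcal T'$. -/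

import Mathlib

universe u v w

/-! ### Argumentation tableaux over an arbitrary set of propositions -/

/-- An argument `(𝒮, φ)`: a set of supporting propositions and a conclusion. -/
abbrev Argument (F : Type u) : Type u := Set F × F

/-- A tableau node is labelled by a set of arguments. -/
abbrev Node (F : Type u) : Type u := Set (Argument F)

/-- The root node `{({σ}, σ) | σ ∈ X}` of a set `X` of available information. -/
def rootNode {F : Type u} (X : Set F) : Node F := {A | ∃ σ ∈ X, A = ({σ}, σ)}

/-- The names of the propositional connectives of a language; below it has exactly two instances,
the formulas of propositional logic and the sentences of predicate logic. -/
class Connectives (F : Type u) where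
  bot : F
  neg : F → F
  conj : F → F → F
  disj : F → F → F
  impl : F → F → F
  biimpl : F → F → F

/-- The symbol `⊤`, read as the abbreviation of `¬⊥`. -/
def Connectives.top {F : Type u} [Connectives F] : F := Connectives.neg Connectives.bot

open Connectives in
/-- The propositional tableau rules. `PropRule Γ [Δ₁, …, Δₖ]` says that some rule applies to
arguments of the node `Γ` and has the `k` alternatives `Δ₁ | … | Δₖ` as its conclusion. -/
inductive PropRule {F : Type u} [Connectives F] (Γ : Node F) : List (Node F) → Prop
  | conj {S : Set F} {φ ψ : F} : (S, conj φ ψ) ∈ Γ → PropRule Γ [{(S, φ), (S, ψ)}]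
  | disj {S : Set F} {φ ψ : F} : (S, disj φ ψ) ∈ Γ → PropRule Γ [{(S, φ)}, {(S, ψ)}]
  | impl {S : Set F} {φ ψ : F} : (S, impl φ ψ) ∈ Γ → PropRule Γ [{(S, neg φ)}, {(S, ψ)}]
  | biimpl {S : Set F} {φ ψ : F} : (S, biimpl φ ψ) ∈ Γ →
      PropRule Γ [{(S, impl φ ψ), (S, impl ψ φ)}]
  | negDisj {S : Set F} {φ ψ : F} : (S, neg (disj φ ψ)) ∈ Γ →
      PropRule Γ [{(S, neg φ), (S, neg ψ)}]
  | negConj {S : Set F} {φ ψ : F} : (S, neg (conj φ ψ)) ∈ Γ →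
      PropRule Γ [{(S, neg φ)}, {(S, neg ψ)}]
  | negImpl {S : Set F} {φ ψ : F} : (S, neg (impl φ ψ)) ∈ Γ →
      PropRule Γ [{(S, φ), (S, neg ψ)}]
  | negBiimpl {S : Set F} {φ ψ : F} : (S, neg (biimpl φ ψ)) ∈ Γ →
      PropRule Γ [{(S, neg (impl φ ψ))}, {(S, neg (impl ψ φ))}]
  | negNeg {S : Set F} {φ : F} : (S, neg (neg φ)) ∈ Γ → PropRule Γ [{(S, φ)}]
  | close {S S' : Set F} {φ : F} : (S, φ) ∈ Γ → (S', neg φ) ∈ Γ →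
      PropRule Γ [{(S ∪ S', bot)}]

/-- Finite tableaux with root label `Γ`, built with the rules `R`: a node is either a leaf, or a
rule `R Γ [Δ₁, …, Δₖ]` has been applied to it and its `k` children are labelled
`Γ ∪ Δ₁, …, Γ ∪ Δₖ`. -/
inductive Tableau {F : Type u} (R : Node F → List (Node F) → Prop) : Node F → Type u
  | leaf (Γ : Node F) : Tableau R Γ
  | node (Γ : Node F) (Δs : List (Node F)) (h : R Γ Δs)
      (child : (i : Fin Δs.length) → Tableau R (Γ ∪ Δs.get i)) : Tableau R Γ

namespace Tableau

variable {F : Type u} {R : Node F → List (Node F) → Prop}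

/-- The (finite) type of leaves of a tableau. -/
def Leaf : {Γ : Node F} → Tableau R Γ → Type
  | _, leaf _ => Unit
  | _, node _ Δs _ child => (i : Fin Δs.length) × (child i).Leaf

/-- The label of a leaf. -/
def label : {Γ : Node F} → (T : Tableau R Γ) → T.Leaf → Node F
  | Γ, leaf _ => fun _ => Γ
  | _, node _ _ _ child => fun l => (child l.1).label l.2

/-- `S` is a support for the closure of `T`: it is the union of sets `s l`, one for each leaf `l`,
with `(s l, ⊥)` in the label of `l`. (In particular `T` is closed.) -/
def IsClosureSupport [Connectives F] {Γ : Node F} (T : Tableau R Γ) (S : Set F) : Prop :=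
  ∃ s : T.Leaf → Set F, (∀ l, (s l, Connectives.bot) ∈ T.label l) ∧ S = ⋃ l, s l

/-- `T.ExtendedBy T'`: the tableau `T'` arises from `T` by applying further rules at the leaves. -/
inductive ExtendedBy : {Γ : Node F} → Tableau R Γ → Tableau R Γ → Prop
  | leaf (Γ : Node F) (T' : Tableau R Γ) : ExtendedBy (leaf Γ) T'
  | node (Γ : Node F) (Δs : List (Node F)) (h : R Γ Δs)
      (child child' : (i : Fin Δs.length) → Tableau R (Γ ∪ Δs.get i)) :
      (∀ i, ExtendedBy (child i) (child' i)) →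
        ExtendedBy (node Γ Δs h child) (node Γ Δs h child')

end Tableau

/-! ### Propositional logic -/

/-- Formulas of propositional logic over a set `α` of atoms. -/
inductive PropFormula (α : Type u) : Type u
  | atom : α → PropFormula α
  | bot : PropFormula α
  | neg : PropFormula α → PropFormula α
  | conj : PropFormula α → PropFormula α → PropFormula α
  | disj : PropFormula α → PropFormula α → PropFormula α
  | impl : PropFormula α → PropFormula α → PropFormula α
  | biimpl : PropFormula α → PropFormula α → PropFormula α

instance PropFormula.instConnectives (α : Type u) : Connectives (PropFormula α) where
  bot := .bot
  neg := .neg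
  conj := .conj
  disj := .disj
  impl := .impl
  biimpl := .biimpl

/-- Truth of a formula under a valuation. -/
def PropFormula.Holds {α : Type u} (val : α → Prop) : PropFormula α → Prop
  | atom a => val a
  | bot => False
  | neg φ => ¬ φ.Holds val
  | conj φ ψ => φ.Holds val ∧ ψ.Holds val
  | disj φ ψ => φ.Holds val ∨ ψ.Holds val
  | impl φ ψ => φ.Holds val → ψ.Holds val
  | biimpl φ ψ => φ.Holds val ↔ ψ.Holds val

/-- A set of formulas is inconsistent if no valuation makes all its elements true. -/
def PropInconsistent {α : Type u} (S : Set (PropFormula α)) : Prop :=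
  ¬ ∃ val : α → Prop, ∀ φ ∈ S, φ.Holds val

/-! ### Predicate logic (without equality) -/

open scoped FirstOrder

/-- Formulas of predicate logic over the signature `L` whose variables are among `Fin n`. The
quantifiers bind the last variable `Fin.last n` of a formula in `n + 1` variables. -/
inductive PredFormula (L : FirstOrder.Language.{u, v}) : ℕ → Type (max u v)
  | rel {n l : ℕ} (r : L.Relations l) (ts : Fin l → L.Term (Fin n)) : PredFormula L n
  | bot {n : ℕ} : PredFormula L n
  | neg {n : ℕ} : PredFormula L n → PredFormula L n
  | conj {n : ℕ} : PredFormula L n → PredFormula L n → PredFormula L n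
  | disj {n : ℕ} : PredFormula L n → PredFormula L n → PredFormula L n
  | impl {n : ℕ} : PredFormula L n → PredFormula L n → PredFormula L n
  | biimpl {n : ℕ} : PredFormula L n → PredFormula L n → PredFormula L n
  | all {n : ℕ} : PredFormula L (n + 1) → PredFormula L n
  | ex {n : ℕ} : PredFormula L (n + 1) → PredFormula L n

/-- The propositions of predicate logic: formulas without free variables. -/
abbrev PredSentence (L : FirstOrder.Language.{u, v}) : Type (max u v) := PredFormula L 0

/-- Ground terms. -/
abbrev GroundTerm (L : FirstOrder.Language.{u, v}) : Type u := L.Term (Fin 0)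

instance PredFormula.instConnectives (L : FirstOrder.Language.{u, v}) : Connectives (PredSentence L) where
  bot := .bot
  neg := .neg
  conj := .conj
  disj := .disj
  impl := .impl
  biimpl := .biimpl

/-- The ground term `t` occurs (as a subterm) in the term given as last argument. -/
def TermOccurs {L : FirstOrder.Language.{u, v}} (t : GroundTerm L) {n : ℕ} : L.Term (Fin n) → Prop
  | .var _ => False
  | .func f ts => FirstOrder.Language.Term.func f ts = t.relabel Fin.elim0 ∨ ∃ i, TermOccurs t (ts i)

namespace PredFormula

variable {L : FirstOrder.Language.{u, v}}

/-- Truth of a formula in an `L`-structure under an assignment to its variables. -/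
def Holds (M : Type w) [L.Structure M] : {n : ℕ} → PredFormula L n → (Fin n → M) → Prop
  | _, rel r ts, x => FirstOrder.Language.Structure.RelMap r fun i => (ts i).realize x
  | _, bot, _ => False
  | _, neg φ, x => ¬ φ.Holds M x
  | _, conj φ ψ, x => φ.Holds M x ∧ ψ.Holds M x
  | _, disj φ ψ, x => φ.Holds M x ∨ ψ.Holds M x
  | _, impl φ ψ, x => φ.Holds M x → ψ.Holds M x
  | _, biimpl φ ψ, x => φ.Holds M x ↔ ψ.Holds M x
  | _, all φ, x => ∀ a : M, φ.Holds M (Fin.snoc x a)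
  | _, ex φ, x => ∃ a : M, φ.Holds M (Fin.snoc x a)

/-- Simultaneous (capture-avoiding) substitution of terms for the free variables. -/
def subst : {n m : ℕ} → PredFormula L n → (Fin n → L.Term (Fin m)) → PredFormula L m
  | _, _, rel r ts, τ => rel r fun i => (ts i).subst τ
  | _, _, bot, _ => bot
  | _, _, neg φ, τ => neg (φ.subst τ)
  | _, _, conj φ ψ, τ => conj (φ.subst τ) (ψ.subst τ)
  | _, _, disj φ ψ, τ => disj (φ.subst τ) (ψ.subst τ)
  | _, _, impl φ ψ, τ => impl (φ.subst τ) (ψ.subst τ)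
  | _, _, biimpl φ ψ, τ => biimpl (φ.subst τ) (ψ.subst τ)
  | _, m, all φ, τ => all (φ.subst
      (Fin.snoc (fun i => (τ i).relabel Fin.castSucc) (FirstOrder.Language.Term.var (Fin.last m))))
  | _, m, ex φ, τ => ex (φ.subst
      (Fin.snoc (fun i => (τ i).relabel Fin.castSucc) (FirstOrder.Language.Term.var (Fin.last m))))

/-- The instance `φ[x/t]` of a formula in the single free variable `x` at a ground term `t`. -/
def inst (φ : PredFormula L 1) (t : GroundTerm L) : PredSentence L := φ.subst fun _ => t

/-- The ground term `t` occurs in a formula. -/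
def Occurs (t : GroundTerm L) : {n : ℕ} → PredFormula L n → Prop
  | _, rel _ ts => ∃ i, TermOccurs t (ts i)
  | _, bot => False
  | _, neg φ => φ.Occurs t
  | _, conj φ ψ => φ.Occurs t ∨ ψ.Occurs t
  | _, disj φ ψ => φ.Occurs t ∨ ψ.Occurs t
  | _, impl φ ψ => φ.Occurs t ∨ ψ.Occurs t
  | _, biimpl φ ψ => φ.Occurs t ∨ ψ.Occurs t
  | _, all φ => φ.Occurs t
  | _, ex φ => φ.Occurs t

end PredFormula

/-- A set of sentences is inconsistent if it has no model (with a non-empty domain). -/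
def PredInconsistent {L : FirstOrder.Language.{u, v}} (S : Set (PredSentence L)) : Prop :=
  ¬ ∃ (M : Type (max u v)) (_ : Nonempty M) (_ : L.Structure M), ∀ φ ∈ S, φ.Holds M Fin.elim0

/-- The ground term `t` occurs in a node: in the conclusion or in the support of an argument. -/
def OccursInNode {L : FirstOrder.Language.{u, v}} (t : GroundTerm L) (Γ : Node (PredSentence L)) : Prop :=
  ∃ A ∈ Γ, A.2.Occurs t ∨ ∃ σ ∈ A.1, σ.Occurs t

/-- The ground terms at which universal claims may be instantiated in the node `Γ`: those which
occur in `Γ`, or, as long as no ground term at all occurs in `Γ`, any constant. -/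
def Instantiable {L : FirstOrder.Language.{u, v}} (Γ : Node (PredSentence L)) (t : GroundTerm L) : Prop :=
  OccursInNode t Γ ∨ ((∀ t' : GroundTerm L, ¬ OccursInNode t' Γ) ∧
    ∃ c : L.Constants, t = c.term)

/-- The tableau rules of predicate logic. -/
inductive PredRule {L : FirstOrder.Language.{u, v}} (Γ : Node (PredSentence L)) :
    List (Node (PredSentence L)) → Prop
  | prop {Δs : List (Node (PredSentence L))} : PropRule Γ Δs → PredRule Γ Δs
  | all {S : Set (PredSentence L)} {φ : PredFormula L 1} {t : GroundTerm L} :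
      (S, φ.all) ∈ Γ → Instantiable Γ t → PredRule Γ [{(S, φ.inst t)}]
  | ex {S : Set (PredSentence L)} {φ : PredFormula L 1} {c : L.Constants} :
      (S, φ.ex) ∈ Γ → ¬ OccursInNode c.term Γ → PredRule Γ [{(S, φ.inst c.term)}]
  | negAll {S : Set (PredSentence L)} {φ : PredFormula L 1} {c : L.Constants} :
      (S, φ.all.neg) ∈ Γ → ¬ OccursInNode c.term Γ → PredRule Γ [{(S, (φ.inst c.term).neg)}]
  | negEx {S : Set (PredSentence L)} {φ : PredFormula L 1} {t : GroundTerm L} :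
      (S, φ.ex.neg) ∈ Γ → Instantiable Γ t → PredRule Γ [{(S, (φ.inst t).neg)}]

/-- The language `ℒ` of predicate logic over the signature `L`, as a set of sentences over the
signature `L[[ℕ]]` used in tableaux. The latter adds countably many constants to `L`, so that
a new constant is always available; the sentences of `ℒ` are those without added constants. -/
def predLanguage (L : FirstOrder.Language.{u, v}) : Set (PredSentence L[[ℕ]]) :=
  {φ | ∀ k : ℕ, ¬ φ.Occurs (L.con k).term}

/-!
Soundness: if the arguments of a node that are supported within `S` all have true conclusions in
some interpretation, then the same is true of one of its children, after a reinterpretation of the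
new constant where one is introduced (`SoundRules`). So a model of a support `S` of a closure would
make `⊥` true at some leaf.

Completeness: since the propositions used by a closure within `S` form an inconsistent set, a
minimal inconsistent `S` is a support as soon as every leaf can be closed by arguments supported
within `S` (`exists_extendedBy_isClosureSupport`). By compactness, which is taken from Mathlib
through a translation of formulas, such an `S` is finite. Let `Γ₀` be a leaf that cannot be closed
within `S`. Only finitely many of its conclusions are supported within `S`, so that all rules
applicable to them at the terms at hand can be performed one after the other, on a branch of nodes
which cannot be closed within `S` either; the node reached has again finitely many such conclusions.
Iterating this gives an infinite branch on which every rule is applied eventually, and its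
conclusions form a Hintikka set `H` that includes `S` (`exists_isHintikka`,
`exists_isPredHintikka`). A Hintikka set has a model (`PropFormula.respects_of_isHintikka`,
`IsPredHintikka.respects`), so `S` is consistent.

Two points need care in predicate logic. Instantiation is restricted to terms which occur in the
node. Hence the domain of the model consists of the terms which occur in `H`, plus one constant if
necessary, and functions whose value would be a term outside of this set get an arbitrary value.
New constants must be available at every node; they are, because a node differs from the root by
finitely many arguments, whose supports are sets of premises (`IsFiniteExtension`).
-/

/-! ### Closable nodes and branches of tableaux -/

namespace Tableau

variable {F : Type u} {R : Node F → List (Node F) → Prop}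

/-- A property of nodes which every alternative of every rule preserves holds at all leaves. -/
theorem forall_leaf {P : Node F → Prop}
    (step : ∀ Γ Δs, R Γ Δs → P Γ → ∀ Δ ∈ Δs, P (Γ ∪ Δ)) {Γ : Node F} (T : Tableau R Γ)
    (hΓ : P Γ) (l : T.Leaf) : P (T.label l) := by
  induction T with
  | leaf Γ => exact hΓ
  | node Γ Δs h child ih =>
    exact ih l.1 (step Γ Δs h hΓ _ (List.get_mem Δs l.1)) l.2

/-- A property of nodes which some alternative of every rule preserves holds at some leaf. -/
theorem exists_leaf {P : Node F → Prop}
    (step : ∀ Γ Δs, R Γ Δs → P Γ → ∃ Δ ∈ Δs, P (Γ ∪ Δ)) {Γ : Node F} (T : Tableau R Γ)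
    (hΓ : P Γ) : ∃ l, P (T.label l) := by
  induction T with
  | leaf Γ => exact ⟨(), hΓ⟩
  | node Γ Δs h child ih =>
    obtain ⟨Δ, hΔ, hP⟩ := step Γ Δs h hΓ
    obtain ⟨i, rfl⟩ := List.get_of_mem hΔ
    obtain ⟨l, hl⟩ := ih i hP
    exact ⟨⟨i, l⟩, hl⟩

variable [Connectives F]

/-- `T.ClosesWithin S`: every leaf of `T` contains an argument for `⊥` with support in `S`. -/
def ClosesWithin {Γ : Node F} (T : Tableau R Γ) (S : Set F) : Prop :=
  ∀ l, ∃ s ⊆ S, (s, Connectives.bot) ∈ T.label l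

variable (R) in
/-- A node is closable within `S` if some tableau rooted at it closes within `S`. -/
def IsClosable (S : Set F) (Γ : Node F) : Prop := ∃ T : Tableau R Γ, T.ClosesWithin S

theorem isClosable_of_bot_mem {S s : Set F} {Γ : Node F} (hs : s ⊆ S)
    (h : (s, Connectives.bot) ∈ Γ) : IsClosable R S Γ :=
  ⟨leaf Γ, fun _ => ⟨s, hs, h⟩⟩

theorem exists_not_isClosable {S : Set F} {Γ : Node F} {Δs : List (Node F)} (h : R Γ Δs)
    (hΓ : ¬ IsClosable R S Γ) : ∃ Δ ∈ Δs, ¬ IsClosable R S (Γ ∪ Δ) := by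
  by_contra! hc
  choose T hT using fun i => hc (Δs.get i) (List.get_mem Δs i)
  exact hΓ ⟨node Γ Δs h T, fun l => hT l.1 l.2⟩

theorem exists_extendedBy_closesWithin {S : Set F} {Γ : Node F} (T : Tableau R Γ)
    (hT : ∀ l, IsClosable R S (T.label l)) :
    ∃ T' : Tableau R Γ, T.ExtendedBy T' ∧ T'.ClosesWithin S := by
  induction T with
  | leaf Γ =>
    obtain ⟨T', hT'⟩ := hT ()
    exact ⟨T', .leaf Γ T', hT'⟩
  | node Γ Δs h child ih =>
    choose T' hext hT' using fun i => ih i fun l => hT ⟨i, l⟩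
    exact ⟨node Γ Δs h T', .node Γ Δs h child T' hext, fun l => hT' l.1 l.2⟩

end Tableau

/-! ### Nodes of a tableau with a given root -/

section Nodes

variable {F : Type u} {R : Node F → List (Node F) → Prop}

/-- Each alternative of a rule adds finitely many arguments, and their supports lie in any set `X`
that includes the supports of all arguments of the node. -/
def ConservativeRules (R : Node F → List (Node F) → Prop) : Prop :=
  ∀ (X : Set F) (Γ : Node F) (Δs : List (Node F)), R Γ Δs → (∀ A ∈ Γ, A.1 ⊆ X) →
    ∀ Δ ∈ Δs, Δ.Finite ∧ ∀ A ∈ Δ, A.1 ⊆ X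

/-- The nodes of tableaux rooted at `rootNode X`: up to finitely many arguments they agree with the
root, and all supports consist of propositions in `X`. -/
structure IsFiniteExtension (X : Set F) (Γ : Node F) : Prop where
  root_subset : rootNode X ⊆ Γ
  finite_diff : (Γ \ rootNode X).Finite
  support_subset : ∀ A ∈ Γ, A.1 ⊆ X

theorem isFiniteExtension_rootNode (X : Set F) : IsFiniteExtension X (rootNode X) where
  root_subset := subset_rfl
  finite_diff := by simp
  support_subset := by
    rintro _ ⟨σ, hσ, rfl⟩
    exact Set.singleton_subset_iff.2 hσ

theorem IsFiniteExtension.union {X : Set F} {Γ Δ : Node F} (h : IsFiniteExtension X Γ)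
    (hfin : Δ.Finite) (hsupp : ∀ A ∈ Δ, A.1 ⊆ X) : IsFiniteExtension X (Γ ∪ Δ) where
  root_subset := h.root_subset.trans Set.subset_union_left
  finite_diff := by
    rw [Set.union_sdiff_distrib]
    exact h.finite_diff.union hfin.sdiff
  support_subset A hA := hA.elim (h.support_subset A) (hsupp A)

theorem isFiniteExtension_label (hR : ConservativeRules R) {X : Set F}
    (T : Tableau R (rootNode X)) (l : T.Leaf) : IsFiniteExtension X (T.label l) :=
  T.forall_leaf (fun Γ Δs h hΓ Δ hΔ =>
    have := hR X Γ Δs h hΓ.support_subset Δ hΔ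
    hΓ.union this.1 this.2) (isFiniteExtension_rootNode X) l

/-- `NodeHolds t S Γ`: the conclusions of all arguments of `Γ` with support in `S` are true. -/
def NodeHolds (t : F → Prop) (S : Set F) (Γ : Node F) : Prop := ∀ A ∈ Γ, A.1 ⊆ S → t A.2

theorem NodeHolds.union {t : F → Prop} {S : Set F} {Γ Δ : Node F} (hΓ : NodeHolds t S Γ)
    (hΔ : NodeHolds t S Δ) : NodeHolds t S (Γ ∪ Δ) :=
  fun A hA => hA.elim (hΓ A) (hΔ A)

end Nodes

/-! ### The propositional rules -/

section PropositionalRules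

variable {F : Type u} [Connectives F]

open Connectives

/-- The propositional rules with one premise, stripped of the supports: `Expands χ [D₁, …, Dₖ]`
says that `χ` is replaced by the alternative sets of conclusions `D₁ | … | Dₖ`. -/
inductive Expands : F → List (Set F) → Prop
  | conj (φ ψ : F) : Expands (conj φ ψ) [{φ, ψ}]
  | disj (φ ψ : F) : Expands (disj φ ψ) [{φ}, {ψ}]
  | impl (φ ψ : F) : Expands (impl φ ψ) [{neg φ}, {ψ}]
  | biimpl (φ ψ : F) : Expands (biimpl φ ψ) [{impl φ ψ, impl ψ φ}]
  | negDisj (φ ψ : F) : Expands (neg (disj φ ψ)) [{neg φ, neg ψ}]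
  | negConj (φ ψ : F) : Expands (neg (conj φ ψ)) [{neg φ}, {neg ψ}]
  | negImpl (φ ψ : F) : Expands (neg (impl φ ψ)) [{φ, neg ψ}]
  | negBiimpl (φ ψ : F) : Expands (neg (biimpl φ ψ)) [{neg (impl φ ψ)}, {neg (impl ψ φ)}]
  | negNeg (φ : F) : Expands (neg (neg φ)) [{φ}]

theorem Expands.finite {χ : F} {Ds : List (Set F)} (h : Expands χ Ds) : ∀ D ∈ Ds, D.Finite := by
  cases h <;> simp

theorem propRule_iff {Γ : Node F} {Δs : List (Node F)} :
    PropRule Γ Δs ↔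
      (∃ s χ Ds, (s, χ) ∈ Γ ∧ Expands χ Ds ∧ Δs = Ds.map (Prod.mk s '' ·)) ∨
      ∃ s s' φ, (s, φ) ∈ Γ ∧ (s', neg φ) ∈ Γ ∧ Δs = [{(s ∪ s', bot)}] := by
  constructor
  · intro h
    cases h with
    | conj h => exact .inl ⟨_, _, _, h, .conj _ _, by simp [Set.image_pair]⟩
    | disj h => exact .inl ⟨_, _, _, h, .disj _ _, by simp⟩
    | impl h => exact .inl ⟨_, _, _, h, .impl _ _, by simp⟩
    | biimpl h => exact .inl ⟨_, _, _, h, .biimpl _ _, by simp [Set.image_pair]⟩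
    | negDisj h => exact .inl ⟨_, _, _, h, .negDisj _ _, by simp [Set.image_pair]⟩
    | negConj h => exact .inl ⟨_, _, _, h, .negConj _ _, by simp⟩
    | negImpl h => exact .inl ⟨_, _, _, h, .negImpl _ _, by simp [Set.image_pair]⟩
    | negBiimpl h => exact .inl ⟨_, _, _, h, .negBiimpl _ _, by simp⟩
    | negNeg h => exact .inl ⟨_, _, _, h, .negNeg _, by simp⟩
    | close h h' => exact .inr ⟨_, _, _, h, h', rfl⟩
  · rintro (⟨s, χ, Ds, h, hχ, rfl⟩ | ⟨s, s', φ, h, h', rfl⟩)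
    · cases hχ with
      | conj => simpa [Set.image_pair] using PropRule.conj h
      | disj => simpa using PropRule.disj h
      | impl => simpa using PropRule.impl h
      | biimpl => simpa [Set.image_pair] using PropRule.biimpl h
      | negDisj => simpa [Set.image_pair] using PropRule.negDisj h
      | negConj => simpa using PropRule.negConj h
      | negImpl => simpa [Set.image_pair] using PropRule.negImpl h
      | negBiimpl => simpa using PropRule.negBiimpl h
      | negNeg => simpa using PropRule.negNeg h
    · exact .close h h'

theorem conservativeRules_propRule : ConservativeRules (PropRule (F := F)) := by
  intro X Γ Δs h hX Δ hΔ
  obtain ⟨s, χ, Ds, hm, hχ, rfl⟩ | ⟨s, s', φ, hm, hm', rfl⟩ := propRule_iff.1 h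
  · obtain ⟨D, hD, rfl⟩ := List.mem_map.1 hΔ
    refine ⟨(hχ.finite D hD).image _, ?_⟩
    rintro _ ⟨φ, -, rfl⟩
    exact hX (s, χ) hm
  · obtain rfl := List.mem_singleton.1 hΔ
    refine ⟨Set.finite_singleton _, ?_⟩
    rintro _ rfl
    exact Set.union_subset (hX _ hm) (hX _ hm')

/-- The truth predicate `t` on propositions interprets the connectives classically. -/
structure IsTruthPredicate (t : F → Prop) : Prop where
  bot : ¬ t bot
  neg (φ : F) : t (neg φ) ↔ ¬ t φ
  conj (φ ψ : F) : t (conj φ ψ) ↔ t φ ∧ t ψ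
  disj (φ ψ : F) : t (disj φ ψ) ↔ t φ ∨ t ψ
  impl (φ ψ : F) : t (impl φ ψ) ↔ (t φ → t ψ)
  biimpl (φ ψ : F) : t (biimpl φ ψ) ↔ (t φ ↔ t ψ)

theorem IsTruthPredicate.exists_of_expands {t : F → Prop} (ht : IsTruthPredicate t) {χ : F}
    {Ds : List (Set F)} (h : Expands χ Ds) (hχ : t χ) : ∃ D ∈ Ds, ∀ φ ∈ D, t φ := by
  cases h <;>
    simp only [ht.neg, ht.conj, ht.disj, ht.impl, ht.biimpl, List.mem_cons, List.not_mem_nil,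
      or_false, exists_eq_or_imp, exists_eq_left, Set.mem_insert_iff, Set.mem_singleton_iff,
      forall_eq_or_imp, forall_eq] at hχ ⊢ <;> tauto

theorem NodeHolds.exists_of_propRule {t : F → Prop} (ht : IsTruthPredicate t) {S : Set F}
    {Γ : Node F} {Δs : List (Node F)} (hΓ : NodeHolds t S Γ) (h : PropRule Γ Δs) :
    ∃ Δ ∈ Δs, NodeHolds t S (Γ ∪ Δ) := by
  obtain ⟨s, χ, Ds, hm, hχ, rfl⟩ | ⟨s, s', φ, hm, hm', rfl⟩ := propRule_iff.1 h
  · by_cases hs : s ⊆ S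
    · obtain ⟨D, hD, hDt⟩ := ht.exists_of_expands hχ (hΓ _ hm hs)
      refine ⟨_, List.mem_map_of_mem hD, hΓ.union ?_⟩
      rintro _ ⟨φ, hφ, rfl⟩ -
      exact hDt φ hφ
    -- an argument that is not supported within `S` puts no constraint on the alternatives
    · have hne : ∃ D, D ∈ Ds := by cases hχ <;> simp
      obtain ⟨D, hD⟩ := hne
      refine ⟨_, List.mem_map_of_mem hD, hΓ.union ?_⟩
      rintro _ ⟨φ, hφ, rfl⟩ hs'
      exact absurd hs' hs
  · refine ⟨_, List.mem_singleton_self _, hΓ.union ?_⟩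
    rintro _ rfl hs
    have hs := Set.union_subset_iff.1 hs
    exact absurd (hΓ _ hm hs.1) ((ht.neg φ).1 (hΓ _ hm' hs.2))

end PropositionalRules

/-! ### Supports of closures, for an abstract semantics -/

section Support

variable {F : Type u} [Connectives F] {R : Node F → List (Node F) → Prop} {I : Type w}
  {sat : I → F → Prop}

/-- Every rule has an alternative that can be made true: if the arguments of a node which are
supported within `S` hold in some interpretation, then so do, possibly in another interpretation,
those of some child. -/
def SoundRules (R : Node F → List (Node F) → Prop) (sat : I → F → Prop) : Prop :=
  ∀ (S : Set F) (Γ : Node F) (Δs : List (Node F)), R Γ Δs → (∃ i, NodeHolds (sat i) S Γ) →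
    ∃ Δ ∈ Δs, ∃ i, NodeHolds (sat i) S (Γ ∪ Δ)

theorem Tableau.IsClosureSupport.subset (hR : ConservativeRules R) {X S : Set F}
    {T : Tableau R (rootNode X)} (h : T.IsClosureSupport S) : S ⊆ X := by
  obtain ⟨s, hs, rfl⟩ := h
  exact Set.iUnion_subset fun l => (isFiniteExtension_label hR T l).support_subset _ (hs l)

/-- Soundness: a model of the support would make the conclusion `⊥` true at some leaf. -/
theorem Tableau.IsClosureSupport.inconsistent (hsound : SoundRules R sat)
    (hbot : ∀ i, ¬ sat i Connectives.bot) {X S : Set F} {T : Tableau R (rootNode X)}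
    (h : T.IsClosureSupport S) : ¬ ∃ i, ∀ φ ∈ S, sat i φ := by
  obtain ⟨s, hs, rfl⟩ := h
  rintro ⟨i, hi⟩
  obtain ⟨l, j, hj⟩ := T.exists_leaf (hsound (⋃ l, s l)) ⟨i, by
    rintro _ ⟨σ, hσ, rfl⟩ hsub
    exact hi σ (hsub rfl)⟩
  exact hbot j (hj _ (hs l) (Set.subset_iUnion s l))

/-- It suffices to close every leaf by arguments supported within `S`: the union of the supports
used is inconsistent, hence all of `S` when `S` is minimal inconsistent. -/
theorem exists_extendedBy_isClosureSupport (hsound : SoundRules R sat)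
    (hbot : ∀ i, ¬ sat i Connectives.bot) {X S : Set F} (T : Tableau R (rootNode X))
    (hmin : Minimal (fun S => ¬ ∃ i, ∀ φ ∈ S, sat i φ) S)
    (hclos : ∀ l, Tableau.IsClosable R S (T.label l)) :
    ∃ T' : Tableau R (rootNode X), T.ExtendedBy T' ∧ T'.IsClosureSupport S := by
  obtain ⟨T', hext, hT'⟩ := T.exists_extendedBy_closesWithin hclos
  choose s hs hbotmem using hT'
  have hsupp : T'.IsClosureSupport (⋃ l, s l) := ⟨s, hbotmem, rfl⟩
  have hsub : (⋃ l, s l) ⊆ S := Set.iUnion_subset hs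
  have := hmin.eq_of_subset (hsupp.inconsistent hsound hbot) hsub
  exact ⟨T', hext, this ▸ hsupp⟩

end Support

/-! ### Hintikka sets -/

section Hintikka

variable {F : Type u} {R : Node F → List (Node F) → Prop}

/-- The conclusions of those arguments of a node that are supported within `S`. -/
def conclusions (S : Set F) (Γ : Node F) : Set F := {φ | ∃ s ⊆ S, (s, φ) ∈ Γ}

theorem conclusions_mono (S : Set F) {Γ Γ' : Node F} (h : Γ ⊆ Γ') :
    conclusions S Γ ⊆ conclusions S Γ' :=
  fun _ ⟨s, hs, hφ⟩ => ⟨s, hs, h hφ⟩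

theorem subset_conclusions_union {S s : Set F} (hs : s ⊆ S) (Γ : Node F) (D : Set F) :
    D ⊆ conclusions S (Γ ∪ Prod.mk s '' D) :=
  fun φ hφ => ⟨s, hs, .inr ⟨φ, hφ, rfl⟩⟩

theorem IsFiniteExtension.finite_conclusions {X S : Set F} {Γ : Node F}
    (h : IsFiniteExtension X Γ) (hS : S.Finite) : (conclusions S Γ).Finite := by
  refine (hS.union (h.finite_diff.image Prod.snd)).subset ?_
  rintro φ ⟨s, hs, hφ⟩
  by_cases hr : (s, φ) ∈ rootNode X
  · obtain ⟨σ, -, hσ⟩ := hr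
    simp only [Prod.mk.injEq] at hσ
    obtain ⟨rfl, rfl⟩ := hσ
    exact .inl (hs rfl)
  · exact .inr ⟨_, ⟨hφ, hr⟩, rfl⟩

variable [Connectives F]

open Connectives

variable (R) in
/-- The nodes on a branch above `Γ₀` along which one keeps to arguments supported within `S` and
never reaches a closable node. -/
structure IsOpenExtension (S : Set F) (Γ₀ Γ : Node F) : Prop where
  subset : Γ₀ ⊆ Γ
  finite_diff : (Γ \ Γ₀).Finite
  support_subset : ∀ A ∈ Γ \ Γ₀, A.1 ⊆ S
  not_isClosable : ¬ Tableau.IsClosable R S Γ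

namespace IsOpenExtension

variable {S : Set F} {Γ₀ Γ : Node F}

theorem union (h : IsOpenExtension R S Γ₀ Γ) {s D : Set F} (hs : s ⊆ S) (hD : D.Finite)
    (hclos : ¬ Tableau.IsClosable R S (Γ ∪ Prod.mk s '' D)) :
    IsOpenExtension R S Γ₀ (Γ ∪ Prod.mk s '' D) where
  subset := h.subset.trans Set.subset_union_left
  finite_diff := by
    rw [Set.union_sdiff_distrib]
    exact h.finite_diff.union (hD.image _).sdiff
  support_subset := by
    rintro A ⟨hA | ⟨φ, -, rfl⟩, hA₀⟩
    exacts [h.support_subset A ⟨hA, hA₀⟩, hs]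
  not_isClosable := hclos

theorem finite_conclusions (h : IsOpenExtension R S Γ₀ Γ) (hfin : (conclusions S Γ₀).Finite) :
    (conclusions S Γ).Finite := by
  refine (hfin.union (h.finite_diff.image Prod.snd)).subset ?_
  rintro φ ⟨s, hs, hφ⟩
  by_cases h₀ : (s, φ) ∈ Γ₀
  · exact .inl ⟨s, hs, h₀⟩
  · exact .inr ⟨_, ⟨hφ, h₀⟩, rfl⟩

theorem bot_notMem (h : IsOpenExtension R S Γ₀ Γ) : bot ∉ conclusions S Γ :=
  fun ⟨_, hs, hbot⟩ => h.not_isClosable (Tableau.isClosable_of_bot_mem hs hbot)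

/-- Some alternative of a rule with a single premise leads to another open node. -/
theorem exists_of_rule (h : IsOpenExtension R S Γ₀ Γ) {s : Set F} (hs : s ⊆ S)
    {Ds : List (Set F)} (hDs : ∀ D ∈ Ds, D.Finite) (hR : R Γ (Ds.map (Prod.mk s '' ·))) :
    ∃ Γ', Γ ⊆ Γ' ∧ IsOpenExtension R S Γ₀ Γ' ∧ ∃ D ∈ Ds, D ⊆ conclusions S Γ' := by
  obtain ⟨Δ, hΔ, hclos⟩ := Tableau.exists_not_isClosable hR h.not_isClosable
  obtain ⟨D, hD, rfl⟩ := List.mem_map.1 hΔ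
  exact ⟨_, Set.subset_union_left, h.union hs (hDs D hD) hclos, D, hD,
    subset_conclusions_union hs Γ D⟩

theorem neg_notMem (hR : ∀ Γ Δs, PropRule Γ Δs → R Γ Δs) (h : IsOpenExtension R S Γ₀ Γ) {φ : F}
    (hφ : φ ∈ conclusions S Γ) : neg φ ∉ conclusions S Γ := by
  obtain ⟨s, hs, hφ⟩ := hφ
  rintro ⟨s', hs', hφ'⟩
  obtain ⟨Γ', -, hΓ', D, hD, hsub⟩ := h.exists_of_rule (s := s ∪ s') (Ds := [{bot}])
    (Set.union_subset hs hs') (by simp) (by simpa using hR _ _ (.close hφ hφ'))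
  obtain rfl := List.mem_singleton.1 hD
  exact hΓ'.bot_notMem (hsub rfl)

/-- A demand `𝒟` asks for one of its members to be included in the conclusions. If every open
extension can be extended so as to meet a given demand, then finitely many demands can be met
together, because a demand once met stays met. -/
theorem exists_forall_demands {Q : Set (Set (Set F))} (hQ : Q.Finite)
    (h : IsOpenExtension R S Γ₀ Γ)
    (hstep : ∀ 𝒟 ∈ Q, ∀ Γ', Γ ⊆ Γ' → IsOpenExtension R S Γ₀ Γ' →
      ∃ Γ'', Γ' ⊆ Γ'' ∧ IsOpenExtension R S Γ₀ Γ'' ∧ ∃ D ∈ 𝒟, D ⊆ conclusions S Γ'') :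
    ∃ Γ', Γ ⊆ Γ' ∧ IsOpenExtension R S Γ₀ Γ' ∧ ∀ 𝒟 ∈ Q, ∃ D ∈ 𝒟, D ⊆ conclusions S Γ' := by
  induction Q, hQ using Set.Finite.induction_on with
  | empty => exact ⟨Γ, subset_rfl, h, by simp⟩
  | @insert 𝒟 Q _ _ ih =>
    obtain ⟨Γ', hsub, hΓ', hmet⟩ := ih fun 𝒟' h' => hstep 𝒟' (.inr h')
    obtain ⟨Γ'', hsub', hΓ'', hD⟩ := hstep 𝒟 (.inl rfl) Γ' hsub hΓ'
    refine ⟨Γ'', hsub.trans hsub', hΓ'', ?_⟩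
    rintro 𝒟' (rfl | h')
    · exact hD
    · obtain ⟨D, hD, hDsub⟩ := hmet 𝒟' h'
      exact ⟨D, hD, hDsub.trans (conclusions_mono S hsub')⟩

end IsOpenExtension

/-- A set of propositions that contains neither `⊥` nor a complementary pair and is closed under
the one-premise propositional rules. -/
structure IsHintikka (H : Set F) : Prop where
  bot_notMem : bot ∉ H
  neg_notMem : ∀ φ ∈ H, neg φ ∉ H
  exists_of_expands : ∀ χ ∈ H, ∀ Ds, Expands χ Ds → ∃ D ∈ Ds, D ⊆ H

/-- The truth predicate `t` makes `φ` true if `φ ∈ H`, and false if `¬φ ∈ H`. -/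
def Respects (t : F → Prop) (H : Set F) (φ : F) : Prop := (φ ∈ H → t φ) ∧ (neg φ ∈ H → ¬ t φ)

namespace IsHintikka

variable {H : Set F} {t : F → Prop} {φ ψ : F}

theorem respects_bot (hH : IsHintikka H) (ht : IsTruthPredicate t) : Respects t H bot :=
  ⟨fun h => absurd h hH.bot_notMem, fun _ => ht.bot⟩

theorem respects_neg (hH : IsHintikka H) (ht : IsTruthPredicate t) (hφ : Respects t H φ) :
    Respects t H (neg φ) := by
  have h := fun h => hH.exists_of_expands _ h _ (.negNeg φ)
  simp only [Respects, List.mem_singleton, exists_eq_left, Set.singleton_subset_iff, ht.neg] at *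
  tauto

theorem respects_conj (hH : IsHintikka H) (ht : IsTruthPredicate t) (hφ : Respects t H φ)
    (hψ : Respects t H ψ) : Respects t H (conj φ ψ) := by
  have h := fun h => hH.exists_of_expands _ h _ (.conj φ ψ)
  have h' := fun h => hH.exists_of_expands _ h _ (.negConj φ ψ)
  simp only [Respects, List.mem_cons, List.not_mem_nil, or_false, exists_eq_or_imp,
    exists_eq_left, Set.insert_subset_iff, Set.singleton_subset_iff, ht.conj] at *
  tauto

theorem respects_disj (hH : IsHintikka H) (ht : IsTruthPredicate t) (hφ : Respects t H φ)
    (hψ : Respects t H ψ) : Respects t H (disj φ ψ) := by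
  have h := fun h => hH.exists_of_expands _ h _ (.disj φ ψ)
  have h' := fun h => hH.exists_of_expands _ h _ (.negDisj φ ψ)
  simp only [Respects, List.mem_cons, List.not_mem_nil, or_false, exists_eq_or_imp,
    exists_eq_left, Set.insert_subset_iff, Set.singleton_subset_iff, ht.disj] at *
  tauto

theorem respects_impl (hH : IsHintikka H) (ht : IsTruthPredicate t) (hφ : Respects t H φ)
    (hψ : Respects t H ψ) : Respects t H (impl φ ψ) := by
  have h := fun h => hH.exists_of_expands _ h _ (.impl φ ψ)
  have h' := fun h => hH.exists_of_expands _ h _ (.negImpl φ ψ)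
  simp only [Respects, List.mem_cons, List.not_mem_nil, or_false, exists_eq_or_imp,
    exists_eq_left, Set.insert_subset_iff, Set.singleton_subset_iff, ht.impl] at *
  tauto

theorem respects_biimpl (hH : IsHintikka H) (ht : IsTruthPredicate t) (hφ : Respects t H φ)
    (hψ : Respects t H ψ) : Respects t H (biimpl φ ψ) := by
  have h := fun h => hH.exists_of_expands _ h _ (.biimpl φ ψ)
  have h' := fun h => hH.exists_of_expands _ h _ (.negBiimpl φ ψ)
  have h₁ := hH.respects_impl ht hφ hψ
  have h₂ := hH.respects_impl ht hψ hφ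
  simp only [List.mem_cons, List.not_mem_nil, or_false, exists_eq_or_imp, exists_eq_left,
    Set.insert_subset_iff, Set.singleton_subset_iff] at h h'
  rw [Respects, ht.biimpl]
  refine ⟨fun hm => ⟨(ht.impl _ _).1 (h₁.1 (h hm).1), (ht.impl _ _).1 (h₂.1 (h hm).2)⟩,
    fun hm hiff => ?_⟩
  obtain hm | hm := h' hm
  · exact h₁.2 hm ((ht.impl _ _).2 hiff.1)
  · exact h₂.2 hm ((ht.impl _ _).2 hiff.2)

end IsHintikka

/-- A node `Γ₀` that is not closable within `S` has a Hintikka set above it: the union of the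
conclusions along an infinite open branch, each segment of which performs all the propositional
expansions, and meets all the additional demands `Q`, of the finitely many conclusions reached by
the segments below it. The Hintikka set is approximated by the nodes of that branch. -/
theorem exists_isHintikka (hR : ∀ Γ Δs, PropRule Γ Δs → R Γ Δs) {S : Set F} {Γ₀ : Node F}
    (hopen : ¬ Tableau.IsClosable R S Γ₀) (hfin : (conclusions S Γ₀).Finite)
    (hexp : ∀ χ : F, {Ds | Expands χ Ds}.Finite) (Q : Set F → Set (Set (Set F)))
    (hQ : ∀ B, B.Finite → (Q B).Finite)
    (hstep : ∀ Γ, IsOpenExtension R S Γ₀ Γ → ∀ 𝒟 ∈ Q (conclusions S Γ),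
      ∀ Γ', Γ ⊆ Γ' → IsOpenExtension R S Γ₀ Γ' →
        ∃ Γ'', Γ' ⊆ Γ'' ∧ IsOpenExtension R S Γ₀ Γ'' ∧ ∃ D ∈ 𝒟, D ⊆ conclusions S Γ'') :
    ∃ H, conclusions S Γ₀ ⊆ H ∧ IsHintikka H ∧ ∀ E ⊆ H, E.Finite →
      ∃ Γ, IsOpenExtension R S Γ₀ Γ ∧ E ⊆ conclusions S Γ ∧ conclusions S Γ ⊆ H ∧
        ∀ 𝒟 ∈ Q (conclusions S Γ), ∃ D ∈ 𝒟, D ⊆ H := by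
  let Q' : Set F → Set (Set (Set F)) := fun B =>
    Q B ∪ ⋃ χ ∈ B, (fun Ds : List (Set F) => {D | D ∈ Ds}) '' {Ds | Expands χ Ds}
  have hnext : ∀ Γ : {Γ // IsOpenExtension R S Γ₀ Γ}, ∃ Γ' : {Γ // IsOpenExtension R S Γ₀ Γ},
      Γ.1 ⊆ Γ'.1 ∧ ∀ 𝒟 ∈ Q' (conclusions S Γ.1), ∃ D ∈ 𝒟, D ⊆ conclusions S Γ'.1 := by
    rintro ⟨Γ, hΓ⟩
    have hB := hΓ.finite_conclusions hfin
    obtain ⟨Γ', hsub, hΓ', hmet⟩ := hΓ.exists_forall_demands (Q := Q' (conclusions S Γ))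
      ((hQ _ hB).union (hB.biUnion fun χ _ => (hexp χ).image _)) <| by
        rintro 𝒟 (h𝒟 | h𝒟) Γ' hsub hΓ'
        · exact hstep Γ hΓ 𝒟 h𝒟 Γ' hsub hΓ'
        · simp only [Set.mem_iUnion] at h𝒟
          obtain ⟨χ, ⟨s, hs, hχ⟩, Ds, hDs, rfl⟩ := h𝒟
          exact hΓ'.exists_of_rule hs hDs.finite
            (hR _ _ (propRule_iff.2 (.inl ⟨s, χ, Ds, hsub hχ, hDs, rfl⟩)))
    exact ⟨⟨Γ', hΓ'⟩, hsub, hmet⟩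
  choose next hnext_sub hnext_met using hnext
  let Γs : ℕ → {Γ // IsOpenExtension R S Γ₀ Γ} := fun n =>
    next^[n] ⟨Γ₀, subset_rfl, by simp, by simp, hopen⟩
  have hsucc : ∀ n, Γs (n + 1) = next (Γs n) := fun n => Function.iterate_succ_apply' _ _ _
  have hmono : Monotone fun n => conclusions S (Γs n).1 :=
    monotone_nat_of_le_succ fun n => conclusions_mono S (by rw [hsucc]; exact hnext_sub _)
  have hle : ∀ n, conclusions S (Γs n).1 ⊆ ⋃ n, conclusions S (Γs n).1 :=
    Set.subset_iUnion fun n => conclusions S (Γs n).1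
  have hmet : ∀ n, ∀ 𝒟 ∈ Q' (conclusions S (Γs n).1), ∃ D ∈ 𝒟, D ⊆ ⋃ n, conclusions S (Γs n).1 := by
    intro n 𝒟 h𝒟
    obtain ⟨D, hD, hsub⟩ := hnext_met _ 𝒟 h𝒟
    rw [← hsucc] at hsub
    exact ⟨D, hD, hsub.trans (hle _)⟩
  have happrox : ∀ E ⊆ ⋃ n, conclusions S (Γs n).1, E.Finite →
      ∃ n, E ⊆ conclusions S (Γs n).1 := by
    intro E hE hEfin
    lift E to Finset F using hEfin
    exact hmono.directed_le.exists_mem_subset_of_finset_subset_biUnion hE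
  refine ⟨⋃ n, conclusions S (Γs n).1, hle 0, ⟨?_, ?_, ?_⟩, ?_⟩
  · intro h
    obtain ⟨n, hn⟩ := Set.mem_iUnion.1 h
    exact (Γs n).2.bot_notMem hn
  · intro φ hφ hφ'
    obtain ⟨n, hn⟩ := happrox {φ, neg φ}
      (Set.insert_subset hφ (Set.singleton_subset_iff.2 hφ')) (by simp)
    exact (Γs n).2.neg_notMem hR (hn (.inl rfl)) (hn (.inr rfl))
  · intro χ hχ Ds hDs
    obtain ⟨n, hn⟩ := Set.mem_iUnion.1 hχ
    exact hmet n _ (.inr (Set.mem_biUnion hn ⟨Ds, hDs, rfl⟩))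
  · intro E hE hEfin
    obtain ⟨n, hn⟩ := happrox E hE hEfin
    exact ⟨(Γs n).1, (Γs n).2, hn, hle n, fun 𝒟 h𝒟 => hmet n 𝒟 (.inl h𝒟)⟩

end Hintikka

/-! ### Propositional logic -/

namespace PropFormula

open FirstOrder FirstOrder.Language

variable {α : Type u}

theorem isTruthPredicate_holds (val : α → Prop) :
    IsTruthPredicate (PropFormula.Holds val) where
  bot := id
  neg _ := Iff.rfl
  conj _ _ := Iff.rfl
  disj _ _ := Iff.rfl
  impl _ _ := Iff.rfl
  biimpl _ _ := Iff.rfl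

theorem finite_expands (χ : PropFormula α) : {Ds | Expands χ Ds}.Finite := by
  refine Set.Subsingleton.finite fun Ds h Ds' h' => ?_
  cases h <;> cases h' <;> rfl

/-- A Hintikka set is true under the valuation that makes exactly its own atoms true. -/
theorem respects_of_isHintikka {H : Set (PropFormula α)} (hH : IsHintikka H) (φ : PropFormula α) :
    Respects (PropFormula.Holds fun a => atom a ∈ H) H φ := by
  have ht := isTruthPredicate_holds fun a : α => atom a ∈ H
  induction φ with
  | atom a => exact ⟨id, fun h h' => hH.neg_notMem _ h' h⟩
  | bot => exact hH.respects_bot ht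
  | neg φ ih => exact hH.respects_neg ht ih
  | conj φ ψ ihφ ihψ => exact hH.respects_conj ht ihφ ihψ
  | disj φ ψ ihφ ihψ => exact hH.respects_disj ht ihφ ihψ
  | impl φ ψ ihφ ihψ => exact hH.respects_impl ht ihφ ihψ
  | biimpl φ ψ ihφ ihψ => exact hH.respects_biimpl ht ihφ ihψ

/-- The language with a nullary predicate for every atom. (The predicates of positive arity, which
are there for uniformity, are not used.) -/
def atomLanguage (α : Type u) : FirstOrder.Language.{0, u} := ⟨fun _ => Empty, fun _ => α⟩

/-- A propositional formula as a sentence of first-order logic. -/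
def toSentence : PropFormula α → (atomLanguage α).Sentence
  | atom a => Relations.formula (L := atomLanguage α) (n := 0) a default
  | bot => ⊥
  | neg φ => φ.toSentence.not
  | conj φ ψ => φ.toSentence ⊓ ψ.toSentence
  | disj φ ψ => φ.toSentence ⊔ ψ.toSentence
  | impl φ ψ => φ.toSentence.imp ψ.toSentence
  | biimpl φ ψ => φ.toSentence.iff ψ.toSentence

theorem realize_toSentence (M : Type v) [(atomLanguage α).Structure M] (φ : PropFormula α) :
    M ⊨ φ.toSentence ↔
      φ.Holds fun a => Structure.RelMap (L := atomLanguage α) (M := M) (n := 0) a default := by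
  induction φ with
  | atom a => exact Formula.realize_rel.trans (iff_of_eq (congrArg _ (Subsingleton.elim _ _)))
  | bot => simp [toSentence, Holds]
  | neg φ ih => simp [toSentence, Holds, ih]
  | conj φ ψ ihφ ihψ => simp [toSentence, Holds, ihφ, ihψ]
  | disj φ ψ ihφ ihψ => simp [toSentence, Holds, ihφ, ihψ]
  | impl φ ψ ihφ ihψ => simp [toSentence, Holds, ihφ, ihψ]
  | biimpl φ ψ ihφ ihψ => simp [toSentence, Holds, ihφ, ihψ]

theorem isSatisfiable_toSentence_iff {S : Set (PropFormula α)} :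
    Theory.IsSatisfiable (toSentence '' S) ↔ ¬ PropInconsistent S := by
  rw [PropInconsistent, not_not]
  constructor
  · rintro ⟨M⟩
    exact ⟨_, fun φ hφ => (realize_toSentence M φ).1
      (Theory.realize_sentence_of_mem _ (Set.mem_image_of_mem _ hφ))⟩
  · rintro ⟨val, hval⟩
    let _ : (atomLanguage α).Structure PUnit.{u + 1} :=
      { funMap := fun f => f.elim, RelMap := fun a _ => val a }
    have : PUnit.{u + 1} ⊨ toSentence '' S := by
      refine ⟨?_⟩
      rintro _ ⟨φ, hφ, rfl⟩
      exact (realize_toSentence _ φ).2 (hval φ hφ)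
    exact Theory.Model.isSatisfiable PUnit

/-- Compactness of propositional logic. -/
theorem exists_finite_inconsistent {S : Set (PropFormula α)} (hS : PropInconsistent S) :
    ∃ S₀ ⊆ S, S₀.Finite ∧ PropInconsistent S₀ := by
  by_contra! hc
  refine isSatisfiable_toSentence_iff.1 (Theory.isSatisfiable_iff_isFinitelySatisfiable.2 ?_) hS
  intro T hT
  have hT' : ∃ T' ⊆ toSentence '' S, T'.Finite ∧ T' = (T : Set _) :=
    ⟨_, hT, T.finite_toSet, rfl⟩
  obtain ⟨S₀, hsub, hfin, himg⟩ := Set.exists_subset_image_finite_and.1 hT'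
  rw [← himg]
  exact isSatisfiable_toSentence_iff.2 (hc S₀ hsub hfin)

/-- Completeness: a finite inconsistent set of premises closes every node of a tableau. -/
theorem isClosable_of_inconsistent {X S : Set (PropFormula α)} (hSX : S ⊆ X) (hfin : S.Finite)
    (hS : PropInconsistent S) {Γ : Node (PropFormula α)} (hΓ : IsFiniteExtension X Γ) :
    Tableau.IsClosable PropRule S Γ := by
  by_contra hopen
  obtain ⟨H, hsub, hH, -⟩ := exists_isHintikka (fun _ _ => id) hopen
    (hΓ.finite_conclusions hfin) finite_expands (fun _ => ∅) (by simp) (by simp)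
  exact hS ⟨_, fun φ hφ => (respects_of_isHintikka hH φ).1
    (hsub ⟨{φ}, Set.singleton_subset_iff.2 hφ, hΓ.root_subset ⟨φ, hSX hφ, rfl⟩⟩)⟩

theorem soundRules : SoundRules (PropRule (F := PropFormula α)) PropFormula.Holds := by
  rintro S Γ Δs h ⟨val, hval⟩
  obtain ⟨Δ, hΔ, hholds⟩ := hval.exists_of_propRule (isTruthPredicate_holds val) h
  exact ⟨Δ, hΔ, val, hholds⟩

end PropFormula

/-! ### Terms and formulas of predicate logic -/

section PredicateSyntax

open FirstOrder FirstOrder.Language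

variable {L : FirstOrder.Language.{u, v}} {n m : ℕ}

theorem termOccurs_relabel (t : GroundTerm L) :
    TermOccurs t (t.relabel (Fin.elim0 : Fin 0 → Fin n)) := by
  cases t with
  | var i => exact i.elim0
  | func f ts => exact .inl rfl

theorem relabel_elim0_injective :
    Function.Injective (Term.relabel Fin.elim0 : GroundTerm L → L.Term (Fin n)) := by
  intro t
  induction t with
  | var i => exact i.elim0
  | func f ts ih =>
    intro t' h
    cases t' with
    | var i => exact i.elim0
    | func g us =>
      simp only [Term.relabel, Term.func.injEq] at h
      obtain ⟨rfl, hfg, h⟩ := h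
      obtain rfl := eq_of_heq hfg
      have h := congrFun (eq_of_heq h)
      exact congrArg _ (funext fun i => ih i (h i))

theorem termOccurs_of_func {l : ℕ} {f : L.Functions l} {us : Fin l → GroundTerm L} (i : Fin l)
    {s : L.Term (Fin n)} (h : TermOccurs (.func f us) s) : TermOccurs (us i) s := by
  induction s with
  | var => exact h
  | func g ts ih =>
    obtain h | ⟨j, hj⟩ := h
    · simp only [Term.relabel, Term.func.injEq] at h
      obtain ⟨rfl, -, h⟩ := h
      obtain rfl := eq_of_heq h
      exact .inr ⟨i, termOccurs_relabel _⟩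
    · exact .inr ⟨j, ih j hj⟩

theorem finite_setOf_termOccurs (s : L.Term (Fin n)) : {t | TermOccurs t s}.Finite := by
  induction s with
  | var => simp [TermOccurs]
  | func f ts ih =>
    have h : {t : GroundTerm L | Term.func f ts = t.relabel Fin.elim0}.Subsingleton :=
      fun t ht t' ht' => relabel_elim0_injective (ht.symm.trans ht')
    refine (h.finite.union (Set.finite_iUnion ih)).subset ?_
    rintro t (ht | ⟨i, hi⟩)
    exacts [.inl ht, .inr (Set.mem_iUnion.2 ⟨i, hi⟩)]

namespace PredFormula

theorem occurs_of_func {l : ℕ} {f : L.Functions l} {us : Fin l → GroundTerm L} (i : Fin l)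
    {φ : PredFormula L n} (h : φ.Occurs (.func f us)) : φ.Occurs (us i) := by
  induction φ with
  | rel r ts =>
    obtain ⟨j, hj⟩ := h
    exact ⟨j, termOccurs_of_func i hj⟩
  | bot => exact h
  | neg φ ih => exact ih h
  | conj φ ψ ihφ ihψ => exact h.imp ihφ ihψ
  | disj φ ψ ihφ ihψ => exact h.imp ihφ ihψ
  | impl φ ψ ihφ ihψ => exact h.imp ihφ ihψ
  | biimpl φ ψ ihφ ihψ => exact h.imp ihφ ihψ
  | all φ ih => exact ih h
  | ex φ ih => exact ih h

theorem finite_setOf_occurs (φ : PredFormula L n) : {t | φ.Occurs t}.Finite := by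
  induction φ with
  | rel r ts =>
    refine (Set.finite_iUnion fun i => finite_setOf_termOccurs (ts i)).subset ?_
    rintro t ⟨i, hi⟩
    exact Set.mem_iUnion.2 ⟨i, hi⟩
  | bot => exact Set.finite_empty
  | neg φ ih => exact ih
  | conj φ ψ ihφ ihψ => exact ihφ.union ihψ
  | disj φ ψ ihφ ihψ => exact ihφ.union ihψ
  | impl φ ψ ihφ ihψ => exact ihφ.union ihψ
  | biimpl φ ψ ihφ ihψ => exact ihφ.union ihψ
  | all φ ih => exact ih
  | ex φ ih => exact ih

/-- The number of connectives and quantifiers of a formula. -/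
def size : {n : ℕ} → PredFormula L n → ℕ
  | _, rel _ _ => 0
  | _, bot => 0
  | _, neg φ => φ.size + 1
  | _, conj φ ψ => φ.size + ψ.size + 1
  | _, disj φ ψ => φ.size + ψ.size + 1
  | _, impl φ ψ => φ.size + ψ.size + 1
  | _, biimpl φ ψ => φ.size + ψ.size + 1
  | _, all φ => φ.size + 1
  | _, ex φ => φ.size + 1

theorem size_subst (φ : PredFormula L n) (τ : Fin n → L.Term (Fin m)) :
    (φ.subst τ).size = φ.size := by
  induction φ generalizing m with
  | rel | bot => rfl
  | neg φ ih => simp [subst, size, ih]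
  | conj φ ψ ihφ ihψ => simp [subst, size, ihφ, ihψ]
  | disj φ ψ ihφ ihψ => simp [subst, size, ihφ, ihψ]
  | impl φ ψ ihφ ihψ => simp [subst, size, ihφ, ihψ]
  | biimpl φ ψ ihφ ihψ => simp [subst, size, ihφ, ihψ]
  | all φ ih => simp [subst, size, ih]
  | ex φ ih => simp [subst, size, ih]

theorem size_inst (φ : PredFormula L 1) (t : GroundTerm L) : (φ.inst t).size = φ.size :=
  size_subst φ _

/-- `IsUniversal χ g`: the sentence `χ` is a universal claim with instances `g t`. -/
inductive IsUniversal : PredSentence L → (GroundTerm L → PredSentence L) → Prop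
  | all (φ : PredFormula L 1) : IsUniversal φ.all φ.inst
  | negEx (φ : PredFormula L 1) : IsUniversal φ.ex.neg fun t => (φ.inst t).neg

/-- `IsExistential χ g`: the sentence `χ` is an existential claim with instances `g t`. -/
inductive IsExistential : PredSentence L → (GroundTerm L → PredSentence L) → Prop
  | ex (φ : PredFormula L 1) : IsExistential φ.ex φ.inst
  | negAll (φ : PredFormula L 1) : IsExistential φ.all.neg fun t => (φ.inst t).neg

theorem finite_isUniversal (χ : PredSentence L) : {g | IsUniversal χ g}.Finite := by
  refine Set.Subsingleton.finite fun g h g' h' => ?_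
  cases h <;> cases h' <;> rfl

theorem finite_isExistential (χ : PredSentence L) : {g | IsExistential χ g}.Finite := by
  refine Set.Subsingleton.finite fun g h g' h' => ?_
  cases h <;> cases h' <;> rfl

theorem finite_expands (χ : PredSentence L) : {Ds | Expands χ Ds}.Finite := by
  refine Set.Subsingleton.finite fun Ds h Ds' h' => ?_
  cases h <;> cases h' <;> rfl

end PredFormula

open PredFormula

theorem predRule_iff {Γ : Node (PredSentence L)} {Δs : List (Node (PredSentence L))} :
    PredRule Γ Δs ↔ PropRule Γ Δs ∨
      (∃ s χ g t, (s, χ) ∈ Γ ∧ IsUniversal χ g ∧ Instantiable Γ t ∧ Δs = [{(s, g t)}]) ∨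
      ∃ s χ g, ∃ c : L.Constants, (s, χ) ∈ Γ ∧ IsExistential χ g ∧ ¬ OccursInNode c.term Γ ∧
        Δs = [{(s, g c.term)}] := by
  constructor
  · intro h
    cases h with
    | prop h => exact .inl h
    | all h ht => exact .inr (.inl ⟨_, _, _, _, h, .all _, ht, rfl⟩)
    | negEx h ht => exact .inr (.inl ⟨_, _, _, _, h, .negEx _, ht, rfl⟩)
    | ex h hc => exact .inr (.inr ⟨_, _, _, _, h, .ex _, hc, rfl⟩)
    | negAll h hc => exact .inr (.inr ⟨_, _, _, _, h, .negAll _, hc, rfl⟩)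
  · rintro (h | ⟨s, χ, g, t, h, hg, ht, rfl⟩ | ⟨s, χ, g, c, h, hg, hc, rfl⟩)
    · exact .prop h
    · cases hg with
      | all => exact .all h ht
      | negEx => exact .negEx h ht
    · cases hg with
      | ex => exact .ex h hc
      | negAll => exact .negAll h hc

theorem conservativeRules_predRule : ConservativeRules (PredRule (L := L)) := by
  intro X Γ Δs h hX
  obtain h | ⟨s, χ, g, t, hm, -, -, rfl⟩ | ⟨s, χ, g, c, hm, -, -, rfl⟩ := predRule_iff.1 h
  · exact conservativeRules_propRule X Γ Δs h hX
  all_goals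
    simp only [List.mem_singleton, forall_eq, Set.finite_singleton, Set.mem_singleton_iff, true_and]
    exact hX (s, χ) hm

end PredicateSyntax

/-! ### Semantics of predicate logic -/

section PredicateSemantics

open FirstOrder FirstOrder.Language

variable {L : FirstOrder.Language.{u, v}} {M : Type w} {n m : ℕ}

namespace PredFormula

theorem isTruthPredicate_holds (M : Type w) [L.Structure M] :
    IsTruthPredicate fun φ : PredSentence L => φ.Holds M Fin.elim0 where
  bot := id
  neg _ := Iff.rfl
  conj _ _ := Iff.rfl
  disj _ _ := Iff.rfl
  impl _ _ := Iff.rfl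
  biimpl _ _ := Iff.rfl

/-- Substitution under a quantifier, semantically: the lifted substitution leaves the bound variable
alone. -/
theorem realize_snoc_relabel [L.Structure M] (τ : Fin n → L.Term (Fin m)) (x : Fin m → M) (a : M) :
    (fun i => (Fin.snoc (α := fun _ => L.Term (Fin (m + 1))) (fun i => (τ i).relabel Fin.castSucc)
      (Term.var (Fin.last m)) i).realize (Fin.snoc (α := fun _ => M) x a)) =
      Fin.snoc (α := fun _ => M) (fun i => (τ i).realize x) a := by
  funext i
  refine Fin.lastCases ?_ (fun i => ?_) i
  · simp
  · simp only [Fin.snoc_castSucc, Term.realize_relabel]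
    congr 1
    funext j
    simp

theorem holds_subst [L.Structure M] (φ : PredFormula L n) (τ : Fin n → L.Term (Fin m))
    (x : Fin m → M) : (φ.subst τ).Holds M x ↔ φ.Holds M fun i => (τ i).realize x := by
  induction φ generalizing m with
  | rel r ts => simp [subst, Holds]
  | bot => rfl
  | neg φ ih => simp [subst, Holds, ih]
  | conj φ ψ ihφ ihψ => simp [subst, Holds, ihφ, ihψ]
  | disj φ ψ ihφ ihψ => simp [subst, Holds, ihφ, ihψ]
  | impl φ ψ ihφ ihψ => simp [subst, Holds, ihφ, ihψ]
  | biimpl φ ψ ihφ ihψ => simp [subst, Holds, ihφ, ihψ]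
  | all φ ih => simp only [subst, Holds, ih, realize_snoc_relabel]
  | ex φ ih => simp only [subst, Holds, ih, realize_snoc_relabel]

theorem holds_inst [L.Structure M] (φ : PredFormula L 1) (t : GroundTerm L) :
    (φ.inst t).Holds M Fin.elim0 ↔
      φ.Holds M (Fin.snoc (α := fun _ => M) Fin.elim0 (t.realize Fin.elim0)) := by
  rw [inst, holds_subst, iff_eq_eq]
  congr 1

theorem IsUniversal.holds [L.Structure M] {χ : PredSentence L} {g : GroundTerm L → PredSentence L}
    (h : IsUniversal χ g) (hχ : χ.Holds M Fin.elim0) (t : GroundTerm L) :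
    (g t).Holds M Fin.elim0 := by
  cases h with
  | all φ => exact (holds_inst φ t).2 (hχ _)
  | negEx φ => exact fun h => hχ ⟨_, (holds_inst φ t).1 h⟩

end PredFormula

open scoped Classical in
/-- The structure obtained by changing the interpretation of the constant `c` to `a`. -/
@[reducible]
noncomputable def updateConstant (I : L.Structure M) (c : L.Constants) (a : M) : L.Structure M where
  funMap {l} f xs := if (⟨l, f⟩ : Σ l, L.Functions l) = ⟨0, c⟩ then a else I.funMap f xs
  RelMap := I.RelMap

theorem realize_updateConstant_term (I : L.Structure M) (c : L.Constants) (a : M)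
    (x : Fin n → M) : @Term.realize L M (updateConstant I c a) _ x c.term = a :=
  if_pos rfl

theorem realize_updateConstant (I : L.Structure M) {c : L.Constants} (a : M) (x : Fin n → M)
    {s : L.Term (Fin n)} (hs : ¬ TermOccurs c.term s) :
    @Term.realize L M (updateConstant I c a) _ x s = @Term.realize L M I _ x s := by
  induction s with
  | var => rfl
  | @func l f ts ih =>
    simp only [TermOccurs, not_or, not_exists] at hs
    have hne : (⟨l, f⟩ : Σ l, L.Functions l) ≠ ⟨0, c⟩ := by
      intro h
      obtain ⟨rfl, h⟩ := Sigma.mk.inj_iff.1 h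
      obtain rfl := eq_of_heq h
      exact hs.1 (congrArg _ (Subsingleton.elim _ _))
    refine (if_neg hne).trans (congrArg _ (funext fun i => ih i (hs.2 i)))

namespace PredFormula

theorem holds_updateConstant (I : L.Structure M) {c : L.Constants} (a : M) (φ : PredFormula L n)
    (x : Fin n → M) (hφ : ¬ φ.Occurs c.term) :
    @Holds L M (updateConstant I c a) _ φ x ↔ @Holds L M I _ φ x := by
  induction φ with
  | rel r ts =>
    have h : ∀ i, ¬ TermOccurs c.term (ts i) := fun i hi => hφ ⟨i, hi⟩
    exact iff_of_eq (congrArg _ (funext fun i => realize_updateConstant I a x (h i)))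
  | bot => rfl
  | neg φ ih => exact not_congr (ih x hφ)
  | conj φ ψ ihφ ihψ =>
    exact and_congr (ihφ x fun h => hφ (.inl h)) (ihψ x fun h => hφ (.inr h))
  | disj φ ψ ihφ ihψ =>
    exact or_congr (ihφ x fun h => hφ (.inl h)) (ihψ x fun h => hφ (.inr h))
  | impl φ ψ ihφ ihψ =>
    exact imp_congr (ihφ x fun h => hφ (.inl h)) (ihψ x fun h => hφ (.inr h))
  | biimpl φ ψ ihφ ihψ =>
    exact iff_congr (ihφ x fun h => hφ (.inl h)) (ihψ x fun h => hφ (.inr h))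
  | all φ ih => exact forall_congr' fun b => ih _ hφ
  | ex φ ih => exact exists_congr fun b => ih _ hφ

/-- An existential claim becomes true of a constant that does not occur in it when that constant is
interpreted as a witness. -/
theorem IsExistential.exists_holds (I : L.Structure M) {χ : PredSentence L}
    {g : GroundTerm L → PredSentence L} (h : IsExistential χ g) {c : L.Constants}
    (hc : ¬ χ.Occurs c.term) (hχ : @Holds L M I _ χ Fin.elim0) :
    ∃ a, @Holds L M (updateConstant I c a) _ (g c.term) Fin.elim0 := by
  cases h with
  | ex φ =>
    obtain ⟨a, ha⟩ := hχ
    refine ⟨a, (@holds_inst _ _ (updateConstant I c a) φ c.term).2 ?_⟩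
    rw [realize_updateConstant_term]
    exact (holds_updateConstant I a φ _ hc).2 ha
  | negAll φ =>
    obtain ⟨a, ha⟩ := not_forall.1 hχ
    refine ⟨a, fun h => ha ?_⟩
    have h := (@holds_inst _ _ (updateConstant I c a) φ c.term).1 h
    rw [realize_updateConstant_term] at h
    exact (holds_updateConstant I a φ _ hc).1 h

end PredFormula

/-- A structure together with its domain, which is not empty. -/
structure PredInterpretation (L : FirstOrder.Language.{u, v}) where
  Domain : Type (max u v)
  nonempty : Nonempty Domain
  struc : L.Structure Domain

/-- Truth of a sentence in a structure. -/
def PredInterpretation.Sat (I : PredInterpretation L) (φ : PredSentence L) : Prop :=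
  @PredFormula.Holds L I.Domain I.struc 0 φ Fin.elim0

theorem predInconsistent_iff {S : Set (PredSentence L)} :
    PredInconsistent S ↔ ¬ ∃ I : PredInterpretation L, ∀ φ ∈ S, I.Sat φ :=
  not_congr ⟨fun ⟨M, hM, I, h⟩ => ⟨⟨M, hM, I⟩, h⟩, fun ⟨I, h⟩ => ⟨_, I.nonempty, I.struc, h⟩⟩

open PredFormula in
theorem soundRules_predRule : SoundRules (PredRule (L := L)) PredInterpretation.Sat := by
  rintro S Γ Δs h ⟨I, hI⟩
  obtain h | ⟨s, χ, g, t, hm, hg, -, rfl⟩ | ⟨s, χ, g, c, hm, hg, hc, rfl⟩ := predRule_iff.1 h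
  · obtain ⟨Δ, hΔ, hholds⟩ :=
      hI.exists_of_propRule (@isTruthPredicate_holds L I.Domain I.struc) h
    exact ⟨Δ, hΔ, I, hholds⟩
  · refine ⟨_, List.mem_singleton_self _, I, hI.union ?_⟩
    rintro _ rfl hs
    exact @IsUniversal.holds L _ I.struc _ _ hg (hI _ hm hs) t
  · refine ⟨_, List.mem_singleton_self _, ?_⟩
    by_cases hs : s ⊆ S
    · obtain ⟨a, ha⟩ := hg.exists_holds I.struc (fun h => hc ⟨_, hm, .inl h⟩) (hI _ hm hs)
      refine ⟨⟨I.Domain, I.nonempty, updateConstant I.struc c a⟩, NodeHolds.union ?_ ?_⟩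
      · intro A hA hAS
        exact (holds_updateConstant I.struc a A.2 _ fun h => hc ⟨A, hA, .inl h⟩).2 (hI A hA hAS)
      · rintro _ rfl -
        exact ha
    · refine ⟨I, hI.union ?_⟩
      rintro _ rfl hs'
      exact absurd hs' hs

namespace PredFormula

/-- Translation into Mathlib's first-order formulas. -/
def toBoundedFormula : {n : ℕ} → PredFormula L n → L.BoundedFormula Empty n
  | _, rel r ts => r.boundedFormula fun i => (ts i).relabel Sum.inr
  | _, bot => ⊥
  | _, neg φ => φ.toBoundedFormula.not
  | _, conj φ ψ => φ.toBoundedFormula ⊓ ψ.toBoundedFormula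
  | _, disj φ ψ => φ.toBoundedFormula ⊔ ψ.toBoundedFormula
  | _, impl φ ψ => φ.toBoundedFormula.imp ψ.toBoundedFormula
  | _, biimpl φ ψ => φ.toBoundedFormula.iff ψ.toBoundedFormula
  | _, all φ => φ.toBoundedFormula.all
  | _, ex φ => φ.toBoundedFormula.ex

theorem realize_toBoundedFormula [L.Structure M] (φ : PredFormula L n) (v : Empty → M)
    (x : Fin n → M) : φ.toBoundedFormula.Realize v x ↔ φ.Holds M x := by
  induction φ with
  | rel r ts => simp [toBoundedFormula, Holds, BoundedFormula.realize_rel, Function.comp_def]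
  | bot => rfl
  | neg φ ih => simp [toBoundedFormula, Holds, ih]
  | conj φ ψ ihφ ihψ => simp [toBoundedFormula, Holds, ihφ, ihψ]
  | disj φ ψ ihφ ihψ => simp [toBoundedFormula, Holds, ihφ, ihψ]
  | impl φ ψ ihφ ihψ => simp [toBoundedFormula, Holds, ihφ, ihψ]
  | biimpl φ ψ ihφ ihψ => simp [toBoundedFormula, Holds, ihφ, ihψ]
  | all φ ih => simp [toBoundedFormula, Holds, ih]
  | ex φ ih => simp [toBoundedFormula, Holds, ih]

theorem models_toBoundedFormula [L.Structure M] (φ : PredSentence L) :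
    M ⊨ (φ.toBoundedFormula : L.Sentence) ↔ φ.Holds M Fin.elim0 := by
  rw [← realize_toBoundedFormula φ default, Subsingleton.elim (Fin.elim0 : Fin 0 → M) default]
  rfl

theorem isSatisfiable_toBoundedFormula_iff {S : Set (PredSentence L)} :
    Theory.IsSatisfiable (L := L) (toBoundedFormula '' S) ↔ ¬ PredInconsistent S := by
  rw [PredInconsistent, not_not]
  constructor
  · rintro ⟨N⟩
    exact ⟨N, inferInstance, inferInstance, fun φ hφ => (models_toBoundedFormula φ).1
      (Theory.realize_sentence_of_mem _ (Set.mem_image_of_mem _ hφ))⟩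
  · rintro ⟨N, _, _, hN⟩
    have : Theory.Model (L := L) N (toBoundedFormula '' S) := by
      refine ⟨?_⟩
      rintro _ ⟨φ, hφ, rfl⟩
      exact (models_toBoundedFormula φ).2 (hN φ hφ)
    exact Theory.Model.isSatisfiable N

/-- Compactness of predicate logic. -/
theorem exists_finite_inconsistent {S : Set (PredSentence L)} (hS : PredInconsistent S) :
    ∃ S₀ ⊆ S, S₀.Finite ∧ PredInconsistent S₀ := by
  by_contra! hc
  refine isSatisfiable_toBoundedFormula_iff.1
    (Theory.isSatisfiable_iff_isFinitelySatisfiable.2 ?_) hS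
  intro T hT
  have hT' : ∃ T' ⊆ toBoundedFormula '' S, T'.Finite ∧ T' = (T : Set _) :=
    ⟨_, hT, T.finite_toSet, rfl⟩
  obtain ⟨S₀, hsub, hfin, himg⟩ := Set.exists_subset_image_finite_and.1 hT'
  rw [← himg]
  exact isSatisfiable_toBoundedFormula_iff.2 (hc S₀ hsub hfin)

end PredFormula

end PredicateSemantics

/-! ### Completeness for predicate logic -/

section PredicateCompleteness

open FirstOrder FirstOrder.Language PredFormula

variable {L : FirstOrder.Language.{u, v}}

/-- A Hintikka set `H` of sentences with domain `D`: a set of ground terms closed under subterms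
that includes all terms occurring in `H`, such that universal claims in `H` are instantiated by all
terms in `D`. The witness of an existential claim need not belong to `D`. -/
structure IsPredHintikka (D : Set (GroundTerm L)) (H : Set (PredSentence L)) : Prop
    extends IsHintikka H where
  nonempty : D.Nonempty
  mem_of_occurs : ∀ φ ∈ H, ∀ t, φ.Occurs t → t ∈ D
  mem_of_func_mem : ∀ {l} (f : L.Functions l) (us : Fin l → GroundTerm L),
    Term.func f us ∈ D → ∀ i, us i ∈ D
  forall_of_isUniversal : ∀ χ ∈ H, ∀ g, IsUniversal χ g → ∀ t ∈ D, g t ∈ H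
  exists_of_isExistential : ∀ χ ∈ H, ∀ g, IsExistential χ g → ∃ t, g t ∈ H

open scoped Classical in
/-- The term structure on a set `D` of ground terms in which the atomic sentences in `H` are true.
Function values outside of `D` are replaced by `d₀`. -/
@[reducible]
noncomputable def termStructure (D : Set (GroundTerm L)) (H : Set (PredSentence L)) (d₀ : D) :
    L.Structure (ULift.{v} D) where
  funMap f xs :=
    ⟨if h : Term.func f (fun i => (xs i).down.1) ∈ D then ⟨_, h⟩ else d₀⟩
  RelMap r xs := PredFormula.rel r (fun i => (xs i).down.1) ∈ H

namespace IsPredHintikka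

variable {D : Set (GroundTerm L)} {H : Set (PredSentence L)}

theorem realize_eq (hH : IsPredHintikka D H) (d₀ : D) (x : Fin 0 → ULift.{v} D) {t : GroundTerm L}
    (ht : t ∈ D) : letI := termStructure D H d₀; t.realize x = ⟨⟨t, ht⟩⟩ := by
  induction t with
  | var i => exact i.elim0
  | func f ts ih =>
    have h : ∀ i, @Term.realize L _ (termStructure D H d₀) _ x (ts i) =
        ⟨⟨ts i, hH.mem_of_func_mem f ts ht i⟩⟩ := fun i => ih i _
    simp only [Term.realize, h]
    exact congrArg ULift.up (dif_pos ht)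

/-- The term structure makes the sentences in `H` true, and those whose negations are in `H` false:
quantifiers range over `D`, and the terms in `D` denote themselves. The induction is on the size of
sentences, since the instances of a quantified sentence are not among its subformulas. -/
theorem respects (hH : IsPredHintikka D H) (d₀ : D) : ∀ φ : PredSentence L,
    letI := termStructure D H d₀
    Respects (fun φ : PredSentence L => φ.Holds (ULift.{v} D) Fin.elim0) H φ
  | .bot => hH.respects_bot (@isTruthPredicate_holds L _ (termStructure D H d₀))
  | .neg φ => hH.respects_neg (@isTruthPredicate_holds L _ (termStructure D H d₀))
      (hH.respects d₀ φ)
  | .conj φ ψ => hH.respects_conj (@isTruthPredicate_holds L _ (termStructure D H d₀))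
      (hH.respects d₀ φ) (hH.respects d₀ ψ)
  | .disj φ ψ => hH.respects_disj (@isTruthPredicate_holds L _ (termStructure D H d₀))
      (hH.respects d₀ φ) (hH.respects d₀ ψ)
  | .impl φ ψ => hH.respects_impl (@isTruthPredicate_holds L _ (termStructure D H d₀))
      (hH.respects d₀ φ) (hH.respects d₀ ψ)
  | .biimpl φ ψ => hH.respects_biimpl (@isTruthPredicate_holds L _ (termStructure D H d₀))
      (hH.respects d₀ φ) (hH.respects d₀ ψ)
  | .rel r ts => by
    let _ := termStructure D H d₀
    -- the terms of an atomic sentence which occurs in `H`, negated or not, denote themselves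
    have key : (∀ i, ts i ∈ D) → ((PredFormula.rel r ts).Holds (ULift.{v} D) Fin.elim0 ↔
        PredFormula.rel r ts ∈ H) := by
      intro h
      simp only [Holds, hH.realize_eq d₀ _ (h _)]
      rfl
    have hocc : ∀ i, (PredFormula.rel r ts).Occurs (ts i) := fun i => ⟨i, by
      have h := termOccurs_relabel (n := 0) (ts i)
      rwa [Subsingleton.elim (Fin.elim0 : Fin 0 → Fin 0) id, Term.relabel_id] at h⟩
    exact ⟨fun h => (key fun i => hH.mem_of_occurs _ h _ (hocc i)).2 h,
      fun h h' => hH.neg_notMem _ ((key fun i => hH.mem_of_occurs _ h _ (hocc i)).1 h') h⟩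
  | .all φ => by
    let _ := termStructure D H d₀
    constructor
    · rintro h ⟨t, ht⟩
      have := (holds_inst φ t).1 <|
        (hH.respects d₀ (φ.inst t)).1 (hH.forall_of_isUniversal _ h _ (.all φ) t ht)
      rwa [hH.realize_eq d₀ _ ht] at this
    · intro h h'
      obtain ⟨t, ht⟩ := hH.exists_of_isExistential _ h _ (.negAll φ)
      exact (hH.respects d₀ (φ.inst t)).2 ht ((holds_inst φ t).2 (h' _))
  | .ex φ => by
    let _ := termStructure D H d₀
    constructor
    · intro h
      obtain ⟨t, ht⟩ := hH.exists_of_isExistential _ h _ (.ex φ)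
      exact ⟨_, (holds_inst φ t).1 ((hH.respects d₀ (φ.inst t)).1 ht)⟩
    · rintro h ⟨⟨t, ht⟩, hφ⟩
      refine (hH.respects d₀ (φ.inst t)).2 (hH.forall_of_isUniversal _ h _ (.negEx φ) t ht)
        ((holds_inst φ t).2 ?_)
      rwa [hH.realize_eq d₀ _ ht]
termination_by φ => φ.size
decreasing_by all_goals simp [size, size_inst]

theorem not_inconsistent (hH : IsPredHintikka D H) : ¬ PredInconsistent H := by
  obtain ⟨t, ht⟩ := hH.nonempty
  exact not_not_intro ⟨ULift D, ⟨⟨⟨t, ht⟩⟩⟩, termStructure D H ⟨t, ht⟩,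
    fun φ hφ => (hH.respects ⟨t, ht⟩ φ).1 hφ⟩

end IsPredHintikka

theorem exists_constant_occursInNode {Γ : Node (PredSentence L)} (t : GroundTerm L)
    (h : OccursInNode t Γ) : ∃ c : L.Constants, OccursInNode c.term Γ := by
  induction t with
  | var i => exact i.elim0
  | @func l f us ih =>
    cases l with
    | zero =>
      refine ⟨f, ?_⟩
      rwa [Constants.term, Subsingleton.elim default us]
    | succ l =>
      refine ih 0 ?_
      obtain ⟨A, hA, h | ⟨σ, hσ, h⟩⟩ := h
      exacts [⟨A, hA, .inl (occurs_of_func 0 h)⟩, ⟨A, hA, .inr ⟨σ, hσ, occurs_of_func 0 h⟩⟩]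

theorem OccursInNode.mono {t : GroundTerm L} {Γ Γ' : Node (PredSentence L)}
    (h : OccursInNode t Γ) (hsub : Γ ⊆ Γ') : OccursInNode t Γ' :=
  let ⟨A, hA, h⟩ := h
  ⟨A, hsub hA, h⟩

/-- The demands made by the quantified sentences in `B`. Universal claims are to be instantiated by
all terms which occur in `B`, and by the constant `c₀`; but if `A` fails, the instance at `c₀` is
waived as soon as any ground term occurs in the conclusions. Existential claims are to be
instantiated by some constant. -/
def quantifierDemands (A : Prop) (c₀ : L.Constants) (B : Set (PredSentence L)) :
    Set (Set (Set (PredSentence L))) :=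
  Set.image2 (fun g t => {{g t}}) (⋃ χ ∈ B, {g | IsUniversal χ g}) (⋃ φ ∈ B, {t | φ.Occurs t}) ∪
  (fun g => {D | D = {g c₀.term} ∨ ¬ A ∧ ∃ φ ∈ D, ∃ t, φ.Occurs t}) ''
    (⋃ χ ∈ B, {g | IsUniversal χ g}) ∪
  (fun g => Set.range fun c : L.Constants => {g c.term}) '' ⋃ χ ∈ B, {g | IsExistential χ g}

theorem finite_quantifierDemands (A : Prop) (c₀ : L.Constants) (B : Set (PredSentence L))
    (hB : B.Finite) : (quantifierDemands A c₀ B).Finite := by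
  have huniv : (⋃ χ ∈ B, {g | IsUniversal χ g}).Finite :=
    hB.biUnion fun χ _ => finite_isUniversal χ
  exact ((huniv.image2 _ (hB.biUnion fun φ _ => finite_setOf_occurs φ)).union (huniv.image _)).union
    ((hB.biUnion fun χ _ => finite_isExistential χ).image _)

theorem IsFiniteExtension.of_isOpenExtension {X S : Set (PredSentence L)}
    {Γ₀ Γ : Node (PredSentence L)} (h₀ : IsFiniteExtension X Γ₀) (hSX : S ⊆ X)
    (h : IsOpenExtension PredRule S Γ₀ Γ) : IsFiniteExtension X Γ where
  root_subset := h₀.root_subset.trans h.subset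
  finite_diff := by
    refine (h₀.finite_diff.union h.finite_diff).subset fun A hA => ?_
    by_cases hA₀ : A ∈ Γ₀
    exacts [.inl ⟨hA₀, hA.2⟩, .inr ⟨hA.1, hA₀⟩]
  support_subset A hA := by
    by_cases hA₀ : A ∈ Γ₀
    exacts [h₀.support_subset A hA₀, (h.support_subset A ⟨hA, hA₀⟩).trans hSX]

theorem IsOpenExtension.occursInNode {X S : Set (PredSentence L)}
    {Γ₀ Γ : Node (PredSentence L)} (h₀ : IsFiniteExtension X Γ₀) (hSX : S ⊆ X)
    (h : IsOpenExtension PredRule S Γ₀ Γ) {t : GroundTerm L} (ht : OccursInNode t Γ) :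
    OccursInNode t Γ₀ ∨ ∃ φ ∈ conclusions S Γ, φ.Occurs t := by
  obtain ⟨A, hA, ht⟩ := ht
  by_cases hA₀ : A ∈ Γ₀
  · exact .inl ⟨A, hA₀, ht⟩
  have hAS := h.support_subset A ⟨hA, hA₀⟩
  obtain ht | ⟨σ, hσ, ht⟩ := ht
  · exact .inr ⟨A.2, ⟨A.1, hAS, hA⟩, ht⟩
  · exact .inl ⟨_, h₀.root_subset ⟨σ, hSX (hAS hσ), rfl⟩, .inl ht⟩

/-- All demands of quantified sentences can be met. At a node where `c₀` may not be used some ground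
term occurs, and if none occurs in `Γ₀`, then it occurs in one of the conclusions, which is the case
where the instance at `c₀` is waived. -/
theorem IsOpenExtension.exists_of_quantifierDemands {X S : Set (PredSentence L)}
    {Γ₀ Γ Γ' : Node (PredSentence L)} (h₀ : IsFiniteExtension X Γ₀) (hSX : S ⊆ X)
    (hfresh : ∀ Γ, IsFiniteExtension X Γ → ∃ c : L.Constants, ¬ OccursInNode c.term Γ)
    {c₀ : L.Constants} (hc₀ : OccursInNode c₀.term Γ₀ ∨ ∀ t, ¬ OccursInNode t Γ₀)
    {𝒟 : Set (Set (PredSentence L))}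
    (h𝒟 : 𝒟 ∈ quantifierDemands (OccursInNode c₀.term Γ₀) c₀ (conclusions S Γ)) (hsub : Γ ⊆ Γ')
    (h : IsOpenExtension PredRule S Γ₀ Γ') :
    ∃ Γ'', Γ' ⊆ Γ'' ∧ IsOpenExtension PredRule S Γ₀ Γ'' ∧ ∃ D ∈ 𝒟, D ⊆ conclusions S Γ'' := by
  have huniv : ∀ χ ∈ conclusions S Γ, ∀ g, IsUniversal χ g → ∀ t, Instantiable Γ' t →
      ∃ Γ'', Γ' ⊆ Γ'' ∧ IsOpenExtension PredRule S Γ₀ Γ'' ∧ {g t} ⊆ conclusions S Γ'' := by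
    rintro χ ⟨s, hs, hχ⟩ g hg t ht
    simpa using h.exists_of_rule (Ds := [{g t}]) hs (by simp)
      (predRule_iff.2 (.inr (.inl ⟨s, χ, g, t, hsub hχ, hg, ht, by simp⟩)))
  obtain (⟨g, hg, t, ht, rfl⟩ | ⟨g, hg, rfl⟩) | ⟨g, hg, rfl⟩ := h𝒟
  · simp only [Set.mem_iUnion] at hg ht
    obtain ⟨χ, hχ, hg⟩ := hg
    obtain ⟨φ, ⟨s, -, hφ⟩, ht⟩ := ht
    obtain ⟨Γ'', hsub', hΓ'', hmem⟩ := huniv χ hχ g hg t (.inl ⟨_, hsub hφ, .inl ht⟩)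
    exact ⟨Γ'', hsub', hΓ'', _, rfl, hmem⟩
  · simp only [Set.mem_iUnion] at hg
    obtain ⟨χ, hχ, hg⟩ := hg
    by_cases hinst : Instantiable Γ' c₀.term
    · obtain ⟨Γ'', hsub', hΓ'', hmem⟩ := huniv χ hχ g hg _ hinst
      exact ⟨Γ'', hsub', hΓ'', _, .inl rfl, hmem⟩
    · have hA : ¬ OccursInNode c₀.term Γ₀ := fun hA => hinst (.inl (hA.mono h.subset))
      obtain ⟨t, ht⟩ : ∃ t, OccursInNode t Γ' := by
        by_contra! hno
        exact hinst (.inr ⟨hno, c₀, rfl⟩)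
      obtain ht | ht := h.occursInNode h₀ hSX ht
      · exact absurd ht (hc₀.resolve_left hA t)
      · obtain ⟨φ, hφ, ht⟩ := ht
        exact ⟨Γ', subset_rfl, h, _, .inr ⟨hA, φ, hφ, t, ht⟩, subset_rfl⟩
  · simp only [Set.mem_iUnion] at hg
    obtain ⟨χ, ⟨s, hs, hχ⟩, hg⟩ := hg
    obtain ⟨c, hc⟩ := hfresh Γ' (h₀.of_isOpenExtension hSX h)
    obtain ⟨Γ'', hsub', hΓ'', hmem⟩ := h.exists_of_rule (Ds := [{g c.term}]) hs (by simp)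
      (predRule_iff.2 (.inr (.inr ⟨s, χ, g, c, hsub hχ, hg, hc, by simp⟩)))
    simp only [List.mem_singleton, exists_eq_left] at hmem
    exact ⟨Γ'', hsub', hΓ'', _, ⟨c, rfl⟩, hmem⟩

/-- A node that is not closable within a finite set `S` of premises has a Hintikka set above it.
Its domain consists of the terms which occur in the Hintikka set together with a constant `c₀`. If
no ground term occurs in the node, then `c₀` is an arbitrary constant, and it is omitted from the
domain should other terms turn up. -/
theorem exists_isPredHintikka {X S : Set (PredSentence L)} (hSX : S ⊆ X) (hfin : S.Finite)
    (hfresh : ∀ Γ, IsFiniteExtension X Γ → ∃ c : L.Constants, ¬ OccursInNode c.term Γ)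
    {Γ₀ : Node (PredSentence L)} (h₀ : IsFiniteExtension X Γ₀)
    (hopen : ¬ Tableau.IsClosable PredRule S Γ₀) :
    ∃ D H, IsPredHintikka D H ∧ conclusions S Γ₀ ⊆ H := by
  obtain ⟨c₀, hc₀⟩ : ∃ c₀ : L.Constants, OccursInNode c₀.term Γ₀ ∨ ∀ t, ¬ OccursInNode t Γ₀ := by
    by_cases h : ∃ t, OccursInNode t Γ₀
    · obtain ⟨t, ht⟩ := h
      obtain ⟨c, hc⟩ := exists_constant_occursInNode t ht
      exact ⟨c, .inl hc⟩
    · obtain ⟨c, -⟩ := hfresh Γ₀ h₀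
      exact ⟨c, .inr fun t ht => h ⟨t, ht⟩⟩
  obtain ⟨H, hsub, hH, happrox⟩ := exists_isHintikka (fun _ _ => .prop) hopen
    (h₀.finite_conclusions hfin) finite_expands
    (quantifierDemands (OccursInNode c₀.term Γ₀) c₀) (finite_quantifierDemands _ c₀)
    (fun Γ _ 𝒟 h𝒟 Γ' hsub hΓ' => hΓ'.exists_of_quantifierDemands h₀ hSX hfresh hc₀ h𝒟 hsub)
  refine ⟨{t | (∃ φ ∈ H, φ.Occurs t) ∨
    t = c₀.term ∧ (OccursInNode c₀.term Γ₀ ∨ ∀ φ ∈ H, ∀ t, ¬ φ.Occurs t)}, H, ?_, hsub⟩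
  refine ⟨hH, ?_, fun φ hφ t ht => .inl ⟨φ, hφ, ht⟩, ?_, ?_, ?_⟩
  · by_cases h : ∃ φ ∈ H, ∃ t, φ.Occurs t
    · obtain ⟨φ, hφ, t, ht⟩ := h
      exact ⟨t, .inl ⟨φ, hφ, ht⟩⟩
    · exact ⟨c₀.term, .inr ⟨rfl, .inr fun φ hφ t ht => h ⟨φ, hφ, t, ht⟩⟩⟩
  · rintro l f us (⟨φ, hφ, h⟩ | ⟨h, -⟩) i
    · exact .inl ⟨φ, hφ, occurs_of_func i h⟩
    · simp only [Constants.term, Term.func.injEq] at h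
      obtain ⟨rfl, -⟩ := h
      exact i.elim0
  · rintro χ hχ g hg t (⟨φ, hφ, ht⟩ | ⟨rfl, hc⟩)
    · obtain ⟨Γ, -, hE, -, hmet⟩ := happrox {χ, φ}
        (Set.insert_subset hχ (Set.singleton_subset_iff.2 hφ)) (by simp)
      obtain ⟨D, rfl, hD⟩ := hmet _ (.inl (.inl ⟨g, Set.mem_biUnion (hE (.inl rfl)) hg, t,
        Set.mem_biUnion (hE (.inr rfl)) ht, rfl⟩))
      exact hD rfl
    · obtain ⟨Γ, -, hE, -, hmet⟩ := happrox {χ} (Set.singleton_subset_iff.2 hχ) (by simp)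
      obtain ⟨D, rfl | ⟨hA, φ, hφ, t, ht⟩, hD⟩ :=
        hmet _ (.inl (.inr ⟨g, Set.mem_biUnion (hE rfl) hg, rfl⟩))
      · exact hD rfl
      · exact absurd ht (hc.resolve_left hA φ (hD hφ) t)
  · intro χ hχ g hg
    obtain ⟨Γ, -, hE, -, hmet⟩ := happrox {χ} (Set.singleton_subset_iff.2 hχ) (by simp)
    obtain ⟨_, ⟨c, rfl⟩, hD⟩ := hmet _ (.inr ⟨g, Set.mem_biUnion (hE rfl) hg, rfl⟩)
    exact ⟨c.term, hD rfl⟩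

/-- Completeness: a finite inconsistent set of premises closes every node of a tableau, provided
that new constants are always available. -/
theorem isClosable_of_predInconsistent {X S : Set (PredSentence L)} (hSX : S ⊆ X)
    (hfin : S.Finite) (hS : PredInconsistent S)
    (hfresh : ∀ Γ, IsFiniteExtension X Γ → ∃ c : L.Constants, ¬ OccursInNode c.term Γ)
    {Γ : Node (PredSentence L)} (hΓ : IsFiniteExtension X Γ) :
    Tableau.IsClosable PredRule S Γ := by
  by_contra hopen
  obtain ⟨D, H, hH, hsub⟩ := exists_isPredHintikka hSX hfin hfresh hΓ hopen
  refine hH.not_inconsistent fun ⟨M, hM, I, hI⟩ => hS ⟨M, hM, I, fun φ hφ => hI φ (hsub ?_)⟩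
  exact ⟨{φ}, Set.singleton_subset_iff.2 hφ, hΓ.root_subset ⟨φ, hSX hφ, rfl⟩⟩

/-- Only finitely many of the added constants occur in a node of a tableau whose root does not
mention them. -/
theorem exists_not_occursInNode {X : Set (PredSentence L[[ℕ]])} (hX : X ⊆ predLanguage L)
    {Γ : Node (PredSentence L[[ℕ]])} (hΓ : IsFiniteExtension X Γ) :
    ∃ c : (L[[ℕ]]).Constants, ¬ OccursInNode c.term Γ := by
  have hinj : Function.Injective fun k : ℕ => ((L.con k).term : GroundTerm L[[ℕ]]) := by
    intro k k' h
    exact Sum.inr.inj (eq_of_heq (Term.func.inj h).2.1)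
  obtain ⟨k, hk⟩ := ((hΓ.finite_diff.biUnion fun A _ => finite_setOf_occurs A.2).preimage
    hinj.injOn).infinite_compl.nonempty
  refine ⟨L.con k, ?_⟩
  rintro ⟨A, hA, h | ⟨σ, hσ, h⟩⟩
  · by_cases hr : A ∈ rootNode X
    · obtain ⟨σ, hσ, rfl⟩ := hr
      exact hX hσ k h
    · exact hk (Set.mem_biUnion ⟨hA, hr⟩ h)
  · exact hX (hΓ.support_subset A hA hσ) k h

end PredicateCompleteness

/-! ### Supports of closures and minimal inconsistent sets -/

theorem mainTheorem2 (α : Type w) (L : FirstOrder.Language.{u, v}) :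
    -- propositional logic with set of atoms `α`
    (∀ (X : Set (PropFormula α)) (T : Tableau PropRule (rootNode X)),
      (∀ S : Set (PropFormula α), T.IsClosureSupport S → S ⊆ X ∧ PropInconsistent S) ∧
      (∀ S : Set (PropFormula α), S ⊆ X → Minimal PropInconsistent S →
        ∃ T' : Tableau PropRule (rootNode X), T.ExtendedBy T' ∧ T'.IsClosureSupport S)) ∧
    -- predicate logic with signature `L`
    (∀ X : Set (PredSentence L[[ℕ]]), X ⊆ predLanguage L →
      ∀ T : Tableau PredRule (rootNode X),
      (∀ S : Set (PredSentence L[[ℕ]]), T.IsClosureSupport S → S ⊆ X ∧ PredInconsistent S) ∧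
      (∀ S : Set (PredSentence L[[ℕ]]), S ⊆ X → Minimal PredInconsistent S →
        ∃ T' : Tableau PredRule (rootNode X), T.ExtendedBy T' ∧ T'.IsClosureSupport S)) := by
  refine ⟨fun X T => ⟨fun S hS => ⟨?_, ?_⟩, fun S hSX hmin => ?_⟩,
    fun X hX T => ⟨fun S hS => ⟨?_, ?_⟩, fun S hSX hmin => ?_⟩⟩
  · exact hS.subset conservativeRules_propRule
  · exact hS.inconsistent PropFormula.soundRules fun _ => id
  · obtain ⟨S₀, hsub, hfin, hS₀⟩ := PropFormula.exists_finite_inconsistent hmin.prop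
    obtain rfl := hmin.eq_of_subset hS₀ hsub
    exact exists_extendedBy_isClosureSupport PropFormula.soundRules (fun _ => id) T hmin fun l =>
      PropFormula.isClosable_of_inconsistent hSX hfin hmin.prop
        (isFiniteExtension_label conservativeRules_propRule T l)
  · exact hS.subset conservativeRules_predRule
  · exact predInconsistent_iff.2 (hS.inconsistent soundRules_predRule fun _ => id)
  · obtain ⟨S₀, hsub, hfin, hS₀⟩ := PredFormula.exists_finite_inconsistent hmin.prop
    obtain rfl := hmin.eq_of_subset hS₀ hsub
    refine exists_extendedBy_isClosureSupport soundRules_predRule (fun _ => id) T ?_ fun l =>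
      isClosable_of_predInconsistent hSX hfin hmin.prop (fun _ => exists_not_occursInNode hX)
        (isFiniteExtension_label conservativeRules_predRule T l)
    simpa only [← predInconsistent_iff] using hmin
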